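/- Let $W_e$ be the domain of the $e$-th partial computable function $\mathbb{N}\to\mathbb{N}$. For equivalence relations $E,F$ on $\mathbb{N}$, write $E\le_c F$ if there is a computable $f:\mathbb{N}\to\mathbb{N}$ with $x\,E\,y\iff f(x)\,F\,f(y)$ for all $x,y$, and call $E,F$ computably bi-reducible if $E\le_c F$ and $F\le_c E$. Let $n\ge 1$. Fix any computable bijective encoding by natural numbers of the pairs of terms (identities) over the generators $x_0,\dots,x_{n-1}$ in the signature $\{0,-,+\}$ of abelian groups. Let $\mathrm{AG}_n[e]$ be the abelian group $\langle x_0,\dots,x_{n-1}\mid W_e\rangle$, i.e. the quotient of the term algebra by the congruence generated by the identities with code in $W_e$ together with all instances of the laws of abelian groups. The isomorphism relation $\cong_{\mathrm{AG}_n}$ of $n$-generated c.e. abelian groups is defined by $e\cong_{\mathrm{AG}_n} i\iff \mathrm{AG}_n[e]\cong \mathrm{AG}_n[i]$. Fix any computable bijection between $\mathbb{N}$ and the ordinals below $\omega\cdot n$, the latter being represented by the exponents and coefficients of their Cantor normal forms, and let $\mathcal{A}$ be the well-ordering of $\mathbb{N}$ that it induces. The relation $E_{\min}(\omega\cdot n)$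 is defined by: $e\;E_{\min}(\omega\cdot n)\;i$ if and only if $W_e$ and $W_i$ have the same $\mathcal{A}$-least element or are both empty. Proposition. For every $n\ge 1$, the relations $\cong_{\mathrm{AG}_n}$ and $E_{\min}(\omega\cdot n)$ are computably bi-reducible. -/

import Mathlib

open Ordinal

noncomputable section

/-! ### Computability: c.e. sets, computable reducibility -/

/-- `ceSet e` is `W_e`, the domain of the `e`-th partial computable function. -/
def ceSet (e : ℕ) : Set ℕ :=
  {x | (Nat.Partrec.Code.eval (Denumerable.ofNat Nat.Partrec.Code e) x).Dom}

/-- `E` is computably reducible to `F`. -/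
def CompReducible (E F : ℕ → ℕ → Prop) : Prop :=
  ∃ h : ℕ → ℕ, Computable h ∧ ∀ x y, E x y ↔ F (h x) (h y)

/-- `E` and `F` are computably bi-reducible. -/
def CompBireducible (E F : ℕ → ℕ → Prop) : Prop :=
  CompReducible E F ∧ CompReducible F E

/-! ### The relations `E_min` -/

/-- `m` is the least element of `S` with respect to the ordering `le`. -/
def IsLeastWrt (le : ℕ → ℕ → Prop) (S : Set ℕ) (m : ℕ) : Prop :=
  m ∈ S ∧ ∀ x ∈ S, le m x

/-- `E_min(𝒜)` for an ordering `𝒜 = (ℕ, le)`: the sets `W_e` and `W_i` have the same least element,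
or are both empty. -/
def EMin (le : ℕ → ℕ → Prop) (e i : ℕ) : Prop :=
  (∃ m, IsLeastWrt le (ceSet e) m ∧ IsLeastWrt le (ceSet i) m) ∨ (ceSet e = ∅ ∧ ceSet i = ∅)

/-- A list `[(e₁, c₁), …, (e_k, c_k)]` is a Cantor normal form (of an ordinal below `ω ^ ω`) if the
exponents are strictly decreasing and the coefficients are positive. -/
def IsCNF (l : List (ℕ × ℕ)) : Prop :=
  l.Pairwise (fun p q => q.1 < p.1) ∧ ∀ p ∈ l, 0 < p.2

/-- The ordinal `ω ^ e₁ * c₁ + ⋯ + ω ^ e_k * c_k` denoted by `[(e₁, c₁), …, (e_k, c_k)]`. -/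
def cnfValue (l : List (ℕ × ℕ)) : Ordinal.{0} :=
  (l.map fun p => ω ^ (p.1 : Ordinal.{0}) * (p.2 : Ordinal.{0})).sum

/-- A computable bijective encoding by natural numbers of the ordinals below `α`, these being
represented by their Cantor normal forms; `decode` is the map from codes to normal forms. -/
structure OrdinalEncoding (α : Ordinal.{0}) where
  decode : ℕ → List (ℕ × ℕ)
  computable_decode : Computable decode
  bijOn_decode : Set.BijOn decode Set.univ {l | IsCNF l ∧ cnfValue l < α}

/-- The ordering of `ℕ` induced by an encoding of the ordinals below `α`. -/
def OrdinalEncoding.le {α : Ordinal.{0}} (h : OrdinalEncoding α) (x y : ℕ) : Prop :=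
  cnfValue (h.decode x) ≤ cnfValue (h.decode y)

/-- The relation `E_min(α)`, formed with the encoding `h` of the ordinals below `α`. -/
def OrdinalEncoding.eMin {α : Ordinal.{0}} (h : OrdinalEncoding α) : ℕ → ℕ → Prop :=
  EMin h.le

/-! ### Terms in the signature of abelian groups -/

/-- The terms over the generators `x_0, …, x_{n-1}` in the signature `0, -, +` of abelian groups. -/
inductive AGTerm (n : ℕ) : Type
  | var (i : Fin n) : AGTerm n
  | zero : AGTerm n
  | neg (t : AGTerm n) : AGTerm n
  | add (s t : AGTerm n) : AGTerm n

namespace AGTerm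

variable {n : ℕ}

/-- A Gödel numbering of the terms. -/
def toNat : AGTerm n → ℕ
  | var i => i
  | zero => n
  | neg t => n + 1 + 2 * t.toNat
  | add s t => n + 1 + (2 * Nat.pair s.toNat t.toNat + 1)

theorem toNat_injective : Function.Injective (toNat (n := n)) := by
  intro s
  induction s with
  | var i =>
    intro t h
    have := i.2
    cases t <;> simp only [toNat] at h
    · rw [Fin.ext h]
    all_goals omega
  | zero =>
    intro t h
    cases t <;> simp only [toNat] at h
    · rename_i j
      have := j.2
      omega
    · rfl
    all_goals omega
  | neg s ih =>
    intro t h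
    cases t <;> simp only [toNat] at h
    · rename_i j
      have := j.2
      omega
    · omega
    · rename_i t
      rw [ih (show s.toNat = t.toNat by omega)]
    · omega
  | add s₁ s₂ ih₁ ih₂ =>
    intro t h
    cases t <;> simp only [toNat] at h
    · rename_i j
      have := j.2
      omega
    · omega
    · omega
    · rename_i t₁ t₂
      obtain ⟨h₁, h₂⟩ := Nat.pair_eq_pair.1
        (show Nat.pair s₁.toNat s₂.toNat = Nat.pair t₁.toNat t₂.toNat by omega)
      rw [ih₁ h₁, ih₂ h₂]

theorem toNat_surjective : Function.Surjective (toNat (n := n)) := by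
  intro m
  induction m using Nat.strong_induction_on with
  | _ m ih =>
    rcases lt_trichotomy m n with h | h | h
    · exact ⟨var ⟨m, h⟩, rfl⟩
    · exact ⟨zero, h.symm⟩
    · rcases Nat.even_or_odd' (m - (n + 1)) with ⟨q, hq | hq⟩
      · obtain ⟨t, ht⟩ := ih q (by omega)
        exact ⟨neg t, by simp only [toNat, ht]; omega⟩
      · have h₁ := Nat.unpair_left_le q
        have h₂ := Nat.unpair_right_le q
        obtain ⟨s, hs⟩ := ih q.unpair.1 (by omega)
        obtain ⟨t, ht⟩ := ih q.unpair.2 (by omega)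
        exact ⟨add s t, by simp only [toNat, hs, ht, Nat.pair_unpair]; omega⟩

/-- The Gödel numbering as a bijection. It only serves to say which functions on terms are
computable. -/
def equivNat (n : ℕ) : AGTerm n ≃ ℕ :=
  Equiv.ofBijective toNat ⟨toNat_injective, toNat_surjective⟩

instance : Primcodable (AGTerm n) := Primcodable.ofEquiv ℕ (equivNat n)

end AGTerm

/-! ### Presentations of abelian groups -/

/-- The congruence on the term algebra generated by the relations `R` together with all instances
of the laws of abelian groups. -/
inductive AGCongr {n : ℕ} (R : Set (AGTerm n × AGTerm n)) : AGTerm n → AGTerm n → Prop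
  | of_rel {s t : AGTerm n} : (s, t) ∈ R → AGCongr R s t
  | refl (s : AGTerm n) : AGCongr R s s
  | symm {s t : AGTerm n} : AGCongr R s t → AGCongr R t s
  | trans {s t u : AGTerm n} : AGCongr R s t → AGCongr R t u → AGCongr R s u
  | neg_congr {s t : AGTerm n} : AGCongr R s t → AGCongr R (.neg s) (.neg t)
  | add_congr {s s' t t' : AGTerm n} :
      AGCongr R s s' → AGCongr R t t' → AGCongr R (.add s t) (.add s' t')
  | add_assoc (s t u : AGTerm n) : AGCongr R (.add (.add s t) u) (.add s (.add t u))
  | add_comm (s t : AGTerm n) : AGCongr R (.add s t) (.add t s)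
  | zero_add (s : AGTerm n) : AGCongr R (.add .zero s) s
  | neg_add_cancel (s : AGTerm n) : AGCongr R (.add (.neg s) s) .zero

def AGCongr.setoid {n : ℕ} (R : Set (AGTerm n × AGTerm n)) : Setoid (AGTerm n) :=
  ⟨AGCongr R, ⟨AGCongr.refl, AGCongr.symm, AGCongr.trans⟩⟩

/-- The abelian group `⟨x_0, …, x_{n-1} ∣ R⟩`, a quotient of the term algebra. -/
def PresentedAG {n : ℕ} (R : Set (AGTerm n × AGTerm n)) : Type :=
  Quotient (AGCongr.setoid R)

instance {n : ℕ} (R : Set (AGTerm n × AGTerm n)) : Add (PresentedAG R) :=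
  ⟨Quotient.map₂ AGTerm.add fun _ _ h _ _ h' => AGCongr.add_congr h h'⟩

instance {n : ℕ} (R : Set (AGTerm n × AGTerm n)) : Zero (PresentedAG R) :=
  ⟨Quotient.mk _ AGTerm.zero⟩

instance {n : ℕ} (R : Set (AGTerm n × AGTerm n)) : Neg (PresentedAG R) :=
  ⟨Quotient.map AGTerm.neg fun _ _ h => AGCongr.neg_congr h⟩

instance {n : ℕ} (R : Set (AGTerm n × AGTerm n)) : AddCommGroup (PresentedAG R) where
  add_assoc := by
    rintro ⟨a⟩ ⟨b⟩ ⟨c⟩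
    exact Quotient.sound (AGCongr.add_assoc a b c)
  add_comm := by
    rintro ⟨a⟩ ⟨b⟩
    exact Quotient.sound (AGCongr.add_comm a b)
  zero_add := by
    rintro ⟨a⟩
    exact Quotient.sound (AGCongr.zero_add a)
  add_zero := by
    rintro ⟨a⟩
    exact Quotient.sound (AGCongr.trans (AGCongr.add_comm _ _) (AGCongr.zero_add a))
  neg_add_cancel := by
    rintro ⟨a⟩
    exact Quotient.sound (AGCongr.neg_add_cancel a)
  nsmul := nsmulRec
  zsmul := zsmulRec

/-- A computable bijective encoding by natural numbers of the pairs of terms (that is, identities)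
over `n` generators; `decode` is the map from codes to identities. -/
structure IdentityEncoding (n : ℕ) where
  decode : ℕ → AGTerm n × AGTerm n
  computable_decode : Computable decode
  bijective_decode : Function.Bijective decode

/-- The `n`-generated c.e. abelian group with index `e`, presented by the identities whose codes
lie in `W_e`. -/
def IdentityEncoding.group {n : ℕ} (c : IdentityEncoding n) (e : ℕ) : Type :=
  PresentedAG (c.decode '' ceSet e)

instance {n : ℕ} (c : IdentityEncoding n) (e : ℕ) : AddCommGroup (c.group e) :=
  inferInstanceAs (AddCommGroup (PresentedAG (c.decode '' ceSet e)))

/-- The isomorphism relation of `n`-generated c.e. abelian groups. -/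
def IdentityEncoding.iso {n : ℕ} (c : IdentityEncoding n) (e i : ℕ) : Prop :=
  Nonempty (c.group e ≃+ c.group i)

/-! ### The encodings exist -/

theorem nonempty_identityEncoding (n : ℕ) : Nonempty (IdentityEncoding n) := by
  have hc : Computable (AGTerm.equivNat n).symm :=
    (Primrec.of_equiv_symm (e := AGTerm.equivNat n)).to_comp
  refine ⟨⟨fun m => ((AGTerm.equivNat n).symm m.unpair.1, (AGTerm.equivNat n).symm m.unpair.2),
    ?_, ?_⟩⟩
  · exact (hc.comp (Computable.fst.comp Computable.unpair)).pair
      (hc.comp (Computable.snd.comp Computable.unpair))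
  · exact (Nat.pairEquiv.symm.trans
      ((AGTerm.equivNat n).symm.prodCongr (AGTerm.equivNat n).symm)).bijective

/-- The Cantor normal form of `ω * i + k`. -/
def cnfPair (i k : ℕ) : List (ℕ × ℕ) :=
  (if i = 0 then [] else [(1, i)]) ++ (if k = 0 then [] else [(0, k)])

theorem cnfValue_cnfPair (i k : ℕ) : cnfValue (cnfPair i k) = ω * i + k := by
  unfold cnfValue cnfPair
  split_ifs <;> simp_all

theorem isCNF_cnfPair (i k : ℕ) : IsCNF (cnfPair i k) := by
  unfold IsCNF cnfPair
  split_ifs <;> simp_all <;> omega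

theorem omega0_mul_add_lt {i k n : ℕ} (h : i < n) : ω * (i : Ordinal.{0}) + k < ω * n := by
  calc ω * (i : Ordinal.{0}) + k < ω * i + ω := by
        gcongr; exact natCast_lt_omega0 k
    _ = ω * ((i + 1 : ℕ) : Ordinal.{0}) := by push_cast; rw [mul_add_one]
    _ ≤ ω * n := by gcongr; omega

theorem eq_cnfPair {n : ℕ} {l : List (ℕ × ℕ)} (hl : IsCNF l) (hv : cnfValue l < ω * n) :
    ∃ i < n, ∃ k, l = cnfPair i k := by
  have key : ∃ i k, l = cnfPair i k := by
    have hexp : ∀ p ∈ l, p.1 ≤ 1 := by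
      intro p hp
      by_contra! h2
      have h0 := hl.2 p hp
      have h1 : ω ^ (p.1 : Ordinal.{0}) * (p.2 : Ordinal.{0}) ≤ cnfValue l :=
        List.le_sum_of_mem (List.mem_map.2 ⟨p, hp, rfl⟩)
      have h3 : ω * (n : Ordinal.{0}) < ω ^ (p.1 : Ordinal.{0}) * (p.2 : Ordinal.{0}) := by
        calc ω * (n : Ordinal.{0}) < ω * ω :=
              mul_lt_mul_of_pos_left (natCast_lt_omega0 n) omega0_pos
          _ = ω ^ ((2 : ℕ) : Ordinal.{0}) := by rw [opow_natCast, pow_two]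
          _ ≤ ω ^ (p.1 : Ordinal.{0}) := opow_le_opow_right omega0_pos (by exact_mod_cast h2)
          _ ≤ _ := le_mul_of_one_le_right' (by exact_mod_cast h0)
      exact absurd (h1.trans_lt hv) h3.not_gt
    obtain ⟨hp, hc⟩ := hl
    match l, hp, hc, hexp with
    | [], _, _, _ => exact ⟨0, 0, rfl⟩
    | [(e, c)], _, hc, he =>
      have := hc (e, c) (by simp)
      have := he (e, c) (by simp)
      simp only at *
      interval_cases e
      · exact ⟨0, c, by simp [cnfPair]; omega⟩
      · exact ⟨c, 0, by simp [cnfPair]; omega⟩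
    | [(e, c), (e', c')], hp, hc, he =>
      have h1 := hc (e, c) (by simp)
      have h2 := hc (e', c') (by simp)
      have h3 := he (e, c) (by simp)
      have h4 : e' < e := by simpa using hp
      simp only at *
      obtain rfl : e = 1 := by omega
      obtain rfl : e' = 0 := by omega
      exact ⟨c, c', by simp [cnfPair, h1.ne', h2.ne']⟩
    | a :: b :: d :: l, hp, _, he =>
      have h3 := he a (by simp)
      simp only [List.pairwise_cons, List.mem_cons] at hp
      have h4 := hp.1 b (by simp)
      have h5 := hp.2.1 d (by simp)
      omega
  obtain ⟨i, k, rfl⟩ := key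
  refine ⟨i, ?_, k, rfl⟩
  by_contra! h
  rw [cnfValue_cnfPair] at hv
  refine absurd hv (not_lt.2 ?_)
  calc ω * (n : Ordinal.{0}) ≤ ω * i := by gcongr
    _ ≤ _ := le_self_add

theorem cnfPair_injective {i k i' k' : ℕ} (h : cnfPair i k = cnfPair i' k') :
    i = i' ∧ k = k' := by
  unfold cnfPair at h
  split_ifs at h <;> simp_all

theorem nonempty_ordinalEncoding {n : ℕ} (hn : 1 ≤ n) :
    Nonempty (OrdinalEncoding (ω * (n : Ordinal.{0}))) := by
  refine ⟨⟨fun m => cnfPair (m % n) (m / n), ?_, ?_, ?_, ?_⟩⟩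
  · apply Primrec.to_comp
    have h1 : Primrec fun m : ℕ => m % n := Primrec.nat_mod.comp Primrec.id (Primrec.const n)
    have h2 : Primrec fun m : ℕ => m / n := Primrec.nat_div.comp Primrec.id (Primrec.const n)
    unfold cnfPair
    refine Primrec.list_append.comp (Primrec.ite ?_ (Primrec.const _) ?_)
      (Primrec.ite ?_ (Primrec.const _) ?_)
    · exact Primrec.eq.comp h1 (Primrec.const 0)
    · exact Primrec.list_cons.comp ((Primrec.const 1).pair h1) (Primrec.const [])
    · exact Primrec.eq.comp h2 (Primrec.const 0)
    · exact Primrec.list_cons.comp ((Primrec.const 0).pair h2) (Primrec.const [])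
  · intro m _
    refine ⟨isCNF_cnfPair _ _, ?_⟩
    rw [cnfValue_cnfPair]
    exact omega0_mul_add_lt (Nat.mod_lt _ hn)
  · intro a _ b _ h
    obtain ⟨h1, h2⟩ := cnfPair_injective h
    rw [← Nat.mod_add_div a n, ← Nat.mod_add_div b n, h1, h2]
  · rintro l ⟨hl, hv⟩
    obtain ⟨i, hi, k, rfl⟩ := eq_cnfPair hl hv
    refine ⟨i + n * k, trivial, ?_⟩
    have h1 : (i + n * k) % n = i := by rw [Nat.add_mul_mod_self_left, Nat.mod_eq_of_lt hi]
    have h2 : (i + n * k) / n = k := by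
      rw [Nat.add_mul_div_left _ _ hn, Nat.div_eq_of_lt hi, Nat.zero_add]
    simp only [h1, h2]

end

/-! A finitely generated abelian group has two invariants, its rank r and the order t of its torsion
subgroup. Along a surjection the rank cannot grow; if the rank stays the same, the torsion order
cannot grow; and if both stay the same, the surjection is injective
(`injective_of_surjective_of_card_torsion_eq`). So proper quotients descend strictly in the
lexicographic order of (r, t), which is where ω · n comes from.

From groups to ordinals: an n-generated group is a product of n cyclic groups ℤ/d_j. Enumerate codes
of ω · rank d + `index d`, over all d ≠ 0 such that `DiagGroup d` maps onto the group. This is c.e.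
because derivability of identities is (`semidec_congr`) and a surjection is witnessed by finitely
many identities (`exists_surjective_diagGroup_iff`). The set depends only on the isomorphism type,
and its least element determines the group, since `index` is injective and increases with the
torsion order (`equiv_of_isLeastWrt`). The free group of rank n gives the empty set.

From ordinals to groups: let ω · i + k impose the relations of ℤ^i × ℤ/2^k. Larger ordinals impose
weaker relations (`chain_dvd_chain`), so the least element of W_e alone determines the group
(`group_equiv_chain`). Distinct ordinals give different invariants, and the empty set gives the free
group of rank n. -/

/-! ### Surjections between finitely generated abelian groups -/

section Surjection

variable {A B : Type*} [AddCommGroup A] [AddCommGroup B]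

/-- Makes `Nat.card` of the torsion a true cardinality; for an infinite type it would be 0. -/
instance finite_torsion_int [Module.Finite ℤ A] : Finite (Submodule.torsion ℤ A) :=
  Module.finite_of_fg_torsion _ Submodule.torsion_isTorsion

theorem finrank_int_le_of_surjective [Module.Finite ℤ A] {f : A →+ B}
    (hf : Function.Surjective f) : Module.finrank ℤ B ≤ Module.finrank ℤ A :=
  LinearMap.finrank_le_finrank_of_surjective (f := f.toIntLinearMap) hf

/-- By additivity of the rank the kernel has rank 0. -/
theorem ker_le_torsion_of_finrank_eq [Module.Finite ℤ A] {f : A →+ B}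
    (hf : Function.Surjective f) (hr : Module.finrank ℤ B = Module.finrank ℤ A) :
    LinearMap.ker f.toIntLinearMap ≤ Submodule.torsion ℤ A := by
  have h1 := (LinearMap.ker f.toIntLinearMap).finrank_quotient_add_finrank
  have h2 := (f.toIntLinearMap.quotKerEquivOfSurjective hf).finrank_eq
  have h3 : Module.finrank ℤ (LinearMap.ker f.toIntLinearMap) = 0 := by omega
  rw [Module.finrank_eq_zero_iff_isTorsion] at h3
  intro x hx
  obtain ⟨a, ha⟩ := @h3 ⟨x, hx⟩
  exact Submodule.mem_torsion_iff _ |>.2 ⟨a, congrArg Subtype.val ha⟩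

theorem map_mem_torsion_int (f : A →+ B) {x : A} (hx : x ∈ Submodule.torsion ℤ A) :
    f x ∈ Submodule.torsion ℤ B := by
  obtain ⟨a, ha⟩ := (Submodule.mem_torsion_iff _).1 hx
  refine (Submodule.mem_torsion_iff _).2 ⟨a, ?_⟩
  have := congrArg f ha
  rwa [map_zero, Submonoid.smul_def, map_zsmul] at this

/-- The map induced on torsion subgroups. -/
def torsionIntMap (f : A →+ B) (x : Submodule.torsion ℤ A) : Submodule.torsion ℤ B :=
  ⟨f x, map_mem_torsion_int f x.2⟩

/-- If a multiple of f x vanishes, that multiple of x lies in the kernel, which is torsion, so x is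
torsion as well. Equal ranks matter: ℤ → ℤ/2 is onto, but not on torsion. -/
theorem torsionIntMap_surjective [Module.Finite ℤ A] {f : A →+ B}
    (hf : Function.Surjective f) (hr : Module.finrank ℤ B = Module.finrank ℤ A) :
    Function.Surjective (torsionIntMap f) := by
  rintro ⟨b, hb⟩
  obtain ⟨x, rfl⟩ := hf b
  obtain ⟨a, ha⟩ := (Submodule.mem_torsion_iff _).1 hb
  have h1 : (a : ℤ) • x ∈ LinearMap.ker f.toIntLinearMap := by
    rw [LinearMap.mem_ker, map_smul]; exact ha
  obtain ⟨a', ha'⟩ := (Submodule.mem_torsion_iff _).1 (ker_le_torsion_of_finrank_eq hf hr h1)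
  refine ⟨⟨x, (Submodule.mem_torsion_iff _).2 ⟨a' * a, ?_⟩⟩, rfl⟩
  rw [mul_smul]; exact ha'

theorem card_torsion_le_of_surjective [Module.Finite ℤ A] {f : A →+ B}
    (hf : Function.Surjective f) (hr : Module.finrank ℤ B = Module.finrank ℤ A) :
    Nat.card (Submodule.torsion ℤ B) ≤ Nat.card (Submodule.torsion ℤ A) :=
  Nat.card_le_card_of_surjective _ (torsionIntMap_surjective hf hr)

/-- The kernel consists of torsion, and on torsion the map is a surjection between finite sets of
equal size. -/
theorem injective_of_surjective_of_card_torsion_eq [Module.Finite ℤ A] {f : A →+ B}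
    (hf : Function.Surjective f) (hr : Module.finrank ℤ B = Module.finrank ℤ A)
    (ht : Nat.card (Submodule.torsion ℤ B) = Nat.card (Submodule.torsion ℤ A)) :
    Function.Injective f := by
  have h1 := (Nat.bijective_iff_surjective_and_card _).2 ⟨torsionIntMap_surjective hf hr, ht.symm⟩
  rw [injective_iff_map_eq_zero]
  intro x hx
  have h2 : x ∈ Submodule.torsion ℤ A := ker_le_torsion_of_finrank_eq hf hr hx
  have h3 := @h1.1 ⟨x, h2⟩ ⟨0, zero_mem _⟩ (Subtype.ext (by simp [torsionIntMap, hx]))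
  exact congrArg Subtype.val h3

theorem finrank_int_eq_of_equiv (e : A ≃+ B) : Module.finrank ℤ A = Module.finrank ℤ B :=
  e.toIntLinearEquiv.finrank_eq

theorem card_torsion_eq_of_equiv (e : A ≃+ B) :
    Nat.card (Submodule.torsion ℤ A) = Nat.card (Submodule.torsion ℤ B) := by
  refine Nat.card_congr ⟨torsionIntMap e.toAddMonoidHom, torsionIntMap e.symm.toAddMonoidHom, ?_, ?_⟩
  · intro x; exact Subtype.ext (e.symm_apply_apply _)
  · intro x; exact Subtype.ext (e.apply_symm_apply _)

end Surjection

/-! ### Products of cyclic groups -/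

/-- The product of the cyclic groups `ℤ / d j`. -/
abbrev DiagGroup {n : ℕ} (d : Fin n → ℕ) : Type := ∀ j, ZMod (d j)

namespace DiagGroup

variable {n : ℕ}

/-- The rank of `DiagGroup d`. -/
def rank (d : Fin n → ℕ) : ℕ := ∑ j, if d j = 0 then 1 else 0

/-- The order of the torsion subgroup of `DiagGroup d`. -/
def torsionCard (d : Fin n → ℕ) : ℕ := ∏ j, if d j = 0 then 1 else d j

instance finite_int (d : Fin n → ℕ) : Module.Finite ℤ (DiagGroup d) := by
  have (j : Fin n) : Module.Finite ℤ (ZMod (d j)) :=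
    Module.Finite.of_surjective (Int.castAddHom (ZMod (d j))).toIntLinearMap
      (ZMod.intCast_surjective)
  infer_instance

theorem torsionCard_pos (d : Fin n → ℕ) : 0 < torsionCard d :=
  Finset.prod_pos fun j _ => by split_ifs <;> omega

theorem mem_torsion_iff {d : Fin n → ℕ} {v : DiagGroup d} :
    v ∈ Submodule.torsion ℤ (DiagGroup d) ↔ ∀ j, d j = 0 → v j = 0 := by
  constructor
  · intro hv j hj
    obtain ⟨a, ha⟩ := (Submodule.mem_torsion_iff _).1 hv
    have h1 : (a : ℤ) • v j = 0 := congrFun ha j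
    have h2 : (a : ℤ) ≠ 0 := nonZeroDivisors.coe_ne_zero a
    revert h1
    -- Generalizing lets `d j` be replaced by 0, and `ZMod 0` is ℤ by definition.
    generalize v j = w
    generalize d j = m at *
    subst hj
    intro h1
    have h3 : (a : ℤ) * (show ℤ from w) = 0 := h1
    exact (mul_eq_zero.1 h3).resolve_left h2
  · intro hv
    refine (Submodule.mem_torsion_iff _).2
      ⟨⟨(torsionCard d : ℤ), mem_nonZeroDivisors_of_ne_zero
        (by exact_mod_cast (torsionCard_pos d).ne')⟩, ?_⟩
    funext j
    change (torsionCard d : ℤ) • v j = 0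
    by_cases hj : d j = 0
    · rw [hv j hj, smul_zero]
    · have h1 : d j ∣ torsionCard d := by
        have := Finset.dvd_prod_of_mem (fun j => if d j = 0 then 1 else d j) (Finset.mem_univ j)
        rw [if_neg hj] at this
        exact this
      rw [natCast_zsmul, _root_.nsmul_eq_mul, (ZMod.natCast_eq_zero_iff _ _).2 h1, zero_mul]

theorem card_torsion (d : Fin n → ℕ) :
    Nat.card (Submodule.torsion ℤ (DiagGroup d)) = torsionCard d := by
  have e : Submodule.torsion ℤ (DiagGroup d) ≃ ∀ j, {w : ZMod (d j) // d j = 0 → w = 0} :=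
    { toFun := fun v j => ⟨v.1 j, mem_torsion_iff.1 v.2 j⟩
      invFun := fun w => ⟨fun j => (w j).1, mem_torsion_iff.2 fun j => (w j).2⟩
      left_inv := fun _ => rfl
      right_inv := fun _ => rfl }
  rw [Nat.card_congr e, Nat.card_pi, torsionCard]
  refine Finset.prod_congr rfl fun j _ => ?_
  split_ifs with hj
  · simp [hj]
  · simp [hj]

/-- The projection to the infinite factors is onto a free group and has torsion kernel. -/
theorem finrank_eq (d : Fin n → ℕ) : Module.finrank ℤ (DiagGroup d) = rank d := by
  let e (j : {j // d j = 0}) : ZMod (d j) ≃+ ℤ := (ZMod.ringEquivCongr j.2).toAddEquiv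
  let f : DiagGroup d →+ ({j // d j = 0} → ℤ) :=
    { toFun := fun v j => e j (v j)
      map_zero' := funext fun j => map_zero (e j)
      map_add' := fun v w => funext fun j => map_add (e j) (v j) (w j) }
  have hf : Function.Surjective f := by
    intro w
    refine ⟨fun j => if h : d j = 0 then (e ⟨j, h⟩).symm (w ⟨j, h⟩) else 0, ?_⟩
    funext j
    change e j (dite _ _ _) = w j
    rw [dif_pos j.2, AddEquiv.apply_symm_apply]
  have h1 := (LinearMap.ker f.toIntLinearMap).finrank_quotient_add_finrank
  have h2 := (f.toIntLinearMap.quotKerEquivOfSurjective hf).finrank_eq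
  have h3 : LinearMap.ker f.toIntLinearMap ≤ Submodule.torsion ℤ (DiagGroup d) := by
    intro v hv
    rw [mem_torsion_iff]
    intro j hj
    have : e ⟨j, hj⟩ (v j) = 0 := congrFun (show f v = 0 from hv) ⟨j, hj⟩
    exact (map_eq_zero_iff _ (e ⟨j, hj⟩).injective).1 this
  have h4 : Module.finrank ℤ (LinearMap.ker f.toIntLinearMap) = 0 := by
    apply Module.IsTorsion.finrank_eq_zero
    rintro ⟨x, hx⟩
    obtain ⟨a, ha⟩ := (Submodule.mem_torsion_iff _).1 (h3 hx)
    exact ⟨a, Subtype.ext ha⟩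
  rw [Module.finrank_fintype_fun_eq_card, Fintype.card_subtype] at h2
  rw [rank, Finset.sum_ite, Finset.sum_const_zero, Finset.sum_const, _root_.smul_eq_mul, mul_one, add_zero]
  omega

theorem rank_zero : rank (0 : Fin n → ℕ) = n := by simp [rank]

theorem rank_lt {d : Fin n → ℕ} (hd : d ≠ 0) : rank d < n := by
  obtain ⟨j, hj⟩ := Function.ne_iff.1 hd
  calc rank d < ∑ _j : Fin n, 1 := by
        refine Finset.sum_lt_sum (fun j _ => by split_ifs <;> simp) ⟨j, Finset.mem_univ j, ?_⟩
        rw [if_neg (show ¬d j = 0 from hj)]; exact one_pos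
    _ = n := by simp

/-- The homomorphism from `DiagGroup d` that sends the `j`-th generator to `g j`. -/
def lift {G : Type*} [AddCommGroup G] {d : Fin n → ℕ} (g : Fin n → G) (hg : ∀ j, d j • g j = 0) :
    DiagGroup d →+ G :=
  ∑ j, (ZMod.lift (d j) ⟨zmultiplesHom G (g j), by simpa using hg j⟩).comp
    (Pi.evalAddMonoidHom (fun j => ZMod (d j)) j)

theorem lift_single {G : Type*} [AddCommGroup G] {d : Fin n → ℕ} (g : Fin n → G)
    (hg : ∀ j, d j • g j = 0) (j : Fin n) : lift g hg (Pi.single j 1) = g j := by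
  have h1 (m : ℕ) (f : {f : ℤ →+ G // f m = 0}) : ZMod.lift m f 1 = f.1 1 := by
    have := ZMod.lift_coe m f 1
    rwa [Int.cast_one] at this
  rw [lift, AddMonoidHom.finsetSum_apply, Finset.sum_eq_single j]
  · simp [h1]
  · intro i _ hi
    simp [Pi.single_eq_of_ne hi]
  · simp

theorem smul_single_one (d : Fin n → ℕ) (j : Fin n) :
    d j • (Pi.single j 1 : DiagGroup d) = 0 := by
  rw [← Pi.single_smul]; simp

theorem hom_ext {G : Type*} [AddCommGroup G] {d : Fin n → ℕ} {f g : DiagGroup d →+ G}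
    (h : ∀ j, f (Pi.single j 1) = g (Pi.single j 1)) : f = g := by
  apply AddMonoidHom.functions_ext
  intro j x
  obtain ⟨z, rfl⟩ := ZMod.intCast_surjective x
  have : (Pi.single j (z : ZMod (d j)) : DiagGroup d) = z • Pi.single j 1 := by
    rw [← Pi.single_smul]; simp
  rw [this, map_zsmul, map_zsmul, h]

/-- An abelian group with `n` generators is a product of `n` cyclic groups. -/
theorem exists_equiv_of_surjective {G : Type*} [AddCommGroup G] (f : (Fin n → ℤ) →+ G)
    (hf : Function.Surjective f) : ∃ d : Fin n → ℕ, Nonempty (G ≃+ DiagGroup d) := by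
  obtain ⟨m, S⟩ := (LinearMap.ker f.toIntLinearMap).smithNormalForm (Pi.basisFun ℤ (Fin n))
  -- Basis vectors outside the range of `S.f` get coefficient 0 and so contribute free factors.
  let a : Fin n → ℤ := Function.extend S.f S.a 0
  have ha (i : Fin m) : a (S.f i) = S.a i := S.f.injective.extend_apply _ _ _
  have ha' (j : Fin n) (hj : j ∉ Set.range S.f) : a j = 0 := Function.extend_apply' _ _ _ hj
  let g : (Fin n → ℤ) →+ DiagGroup fun j => (a j).natAbs :=
    { toFun := fun v j => ((S.bM.repr v j : ℤ) : ZMod (a j).natAbs)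
      map_zero' := by funext j; simp
      map_add' := fun v w => by funext j; simp }
  have hg : Function.Surjective g := by
    intro w
    choose z hz using fun j => ZMod.intCast_surjective (w j)
    refine ⟨S.bM.equivFun.symm z, ?_⟩
    funext j
    simp only [g, AddMonoidHom.coe_mk, ZeroHom.coe_mk, ← Module.Basis.equivFun_apply,
      LinearEquiv.apply_symm_apply, hz]
  have hdvd (v : Fin n → ℤ) : g v = 0 ↔ ∀ j, a j ∣ S.bM.repr v j := by
    rw [funext_iff]
    refine forall_congr' fun j => ?_
    simp [g, ZMod.intCast_zmod_eq_zero_iff_dvd]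
  -- In the Smith basis, v lies in the kernel iff each coordinate is divisible by the corresponding
  -- `a j`.
  have hker : LinearMap.ker f.toIntLinearMap = LinearMap.ker g.toIntLinearMap := by
    ext v
    rw [LinearMap.mem_ker (f := g.toIntLinearMap), AddMonoidHom.coe_toIntLinearMap, hdvd]
    constructor
    · intro hv j
      by_cases hj : j ∈ Set.range S.f
      · obtain ⟨i, rfl⟩ := hj
        have := S.repr_apply_embedding_eq_repr_smul (m := ⟨v, hv⟩) (i := i)
        rw [ha, this, map_smul]
        exact ⟨_, rfl⟩
      · rw [S.repr_eq_zero_of_notMem_range ⟨v, hv⟩ hj]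
        exact dvd_zero _
    · intro hv
      rw [← S.bM.sum_repr v]
      refine sum_mem fun j _ => ?_
      obtain ⟨q, hq⟩ := hv j
      by_cases hj : j ∈ Set.range S.f
      · obtain ⟨i, rfl⟩ := hj
        rw [hq, ha, mul_comm, mul_smul, ← S.snf]
        exact Submodule.smul_mem _ _ (S.bN i).2
      · rw [hq, ha' j hj, zero_mul, zero_smul]
        exact zero_mem _
  exact ⟨_, ⟨((f.toIntLinearMap.quotKerEquivOfSurjective hf).symm.trans
    ((Submodule.quotEquivOfEq _ _ hker).trans
      (g.toIntLinearMap.quotKerEquivOfSurjective hg))).toAddEquiv⟩⟩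

end DiagGroup

/-! ### Homomorphisms from presented groups -/

namespace AGTerm

variable {n : ℕ}

/-- The value of a term in an abelian group. -/
def eval {H : Type*} [AddCommGroup H] (g : Fin n → H) : AGTerm n → H
  | var i => g i
  | zero => 0
  | neg t => -eval g t
  | add s t => eval g s + eval g t

/-- The term `t + ⋯ + t`. -/
def nsmul : ℕ → AGTerm n → AGTerm n
  | 0, _ => zero
  | k + 1, t => add (nsmul k t) t

/-- The sum of a list of terms. -/
def sum (l : List (AGTerm n)) : AGTerm n := l.foldr add zero

/-- The linear combination of the terms `P i` with the coefficients `(C i).1 - (C i).2`. -/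
def comb (C : Fin n → ℕ × ℕ) (P : Fin n → AGTerm n) : AGTerm n :=
  sum (List.ofFn fun i => add (nsmul (C i).1 (P i)) (neg (nsmul (C i).2 (P i))))

theorem eval_nsmul {H : Type*} [AddCommGroup H] (g : Fin n → H) (k : ℕ) (t : AGTerm n) :
    eval g (nsmul k t) = k • eval g t := by
  induction k with
  | zero => simp [nsmul, eval]
  | succ k ih => simp [nsmul, eval, ih, succ_nsmul]

end AGTerm

namespace PresentedAG

variable {n : ℕ} {R : Set (AGTerm n × AGTerm n)}

/-- The element of the presented group denoted by a term. -/
def mk (R : Set (AGTerm n × AGTerm n)) (t : AGTerm n) : PresentedAG R :=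
  Quotient.mk (AGCongr.setoid R) t

theorem mk_surjective : Function.Surjective (mk R) := Quotient.mk_surjective

theorem mk_eq_mk {s t : AGTerm n} : mk R s = mk R t ↔ AGCongr R s t :=
  Quotient.eq (r := AGCongr.setoid R)

theorem mk_zero : mk R .zero = 0 := rfl

theorem mk_neg (t : AGTerm n) : mk R (.neg t) = -mk R t := rfl

theorem mk_add (s t : AGTerm n) : mk R (.add s t) = mk R s + mk R t := rfl

theorem mk_nsmul (k : ℕ) (t : AGTerm n) : mk R (.nsmul k t) = k • mk R t := by
  induction k with
  | zero => rw [zero_nsmul]; rfl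
  | succ k ih => rw [succ_nsmul, ← ih]; rfl

theorem mk_sum (l : List (AGTerm n)) : mk R (.sum l) = (l.map (mk R)).sum := by
  induction l with
  | nil => rfl
  | cons t l ih => rw [List.map_cons, List.sum_cons, ← ih]; rfl

theorem mk_comb (C : Fin n → ℕ × ℕ) (P : Fin n → AGTerm n) :
    mk R (.comb C P) = ∑ i, (((C i).1 : ℤ) - (C i).2) • mk R (P i) := by
  rw [AGTerm.comb, mk_sum, List.map_ofFn, List.sum_ofFn]
  refine Finset.sum_congr rfl fun i _ => ?_
  rw [Function.comp_apply, mk_add, mk_neg, mk_nsmul, mk_nsmul, sub_smul, natCast_zsmul,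
    natCast_zsmul, sub_eq_add_neg]

theorem eval_eq_of_congr {H : Type*} [AddCommGroup H] (g : Fin n → H)
    (hg : ∀ p ∈ R, p.1.eval g = p.2.eval g) {s t : AGTerm n} (h : AGCongr R s t) :
    s.eval g = t.eval g := by
  induction h with
  | of_rel h => exact hg _ h
  | refl => rfl
  | symm _ ih => exact ih.symm
  | trans _ _ ih₁ ih₂ => exact ih₁.trans ih₂
  | neg_congr _ ih => simp only [AGTerm.eval, ih]
  | add_congr _ _ ih₁ ih₂ => simp only [AGTerm.eval, ih₁, ih₂]
  | add_assoc => exact _root_.add_assoc _ _ _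
  | add_comm => exact _root_.add_comm _ _
  | zero_add => exact _root_.zero_add _
  | neg_add_cancel => exact _root_.neg_add_cancel _

/-- The homomorphism given by the values of the generators. -/
def lift {H : Type*} [AddCommGroup H] (g : Fin n → H)
    (hg : ∀ p ∈ R, p.1.eval g = p.2.eval g) : PresentedAG R →+ H where
  toFun := Quotient.lift (AGTerm.eval g) fun _ _ h => eval_eq_of_congr g hg h
  map_zero' := rfl
  map_add' := by rintro ⟨a⟩ ⟨b⟩; rfl

theorem mem_of_forall_var_mem {K : AddSubgroup (PresentedAG R)} (hK : ∀ j, mk R (.var j) ∈ K)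
    (x : PresentedAG R) : x ∈ K := by
  obtain ⟨t, rfl⟩ := mk_surjective x
  induction t with
  | var i => exact hK i
  | zero => exact K.zero_mem
  | neg t ih => exact K.neg_mem ih
  | add s t ihs iht => exact K.add_mem ihs iht

theorem surjective_of_forall_var {H : Type*} [AddCommGroup H] {f : H →+ PresentedAG R}
    (hf : ∀ j, ∃ y, f y = mk R (.var j)) : Function.Surjective f :=
  fun x => mem_of_forall_var_mem (K := f.range) hf x

theorem exists_equiv_diagGroup (R : Set (AGTerm n × AGTerm n)) :
    ∃ d : Fin n → ℕ, Nonempty (PresentedAG R ≃+ DiagGroup d) := by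
  refine DiagGroup.exists_equiv_of_surjective
    (Fintype.linearCombination ℤ fun j => mk R (.var j)).toAddMonoidHom ?_
  refine surjective_of_forall_var fun j => ⟨Pi.single j 1, ?_⟩
  simp [Fintype.linearCombination_apply_single]

/-- A homomorphism from the product is a choice of elements killed by the `d j`; it is onto iff
every generator is an integer combination of them. Both conditions are finitely many derivable
identities, which makes the right side semidecidable. -/
theorem exists_surjective_diagGroup_iff {d : Fin n → ℕ} :
    (∃ f : DiagGroup d →+ PresentedAG R, Function.Surjective f) ↔
      ∃ (P : Fin n → AGTerm n) (C : Fin n → Fin n → ℕ × ℕ),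
        (∀ j, AGCongr R (.nsmul (d j) (P j)) .zero) ∧
          ∀ j, AGCongr R (.var j) (.comb (C j) P) := by
  simp only [← mk_eq_mk, mk_nsmul, mk_zero, mk_comb]
  constructor
  · rintro ⟨f, hf⟩
    choose P hP using fun j => mk_surjective (f (Pi.single j 1))
    choose v hv using fun j => hf (mk R (.var j))
    choose z hz using fun j i => ZMod.intCast_surjective (v j i)
    -- An integer is written as the difference of its positive and negative parts.
    refine ⟨P, fun j i => ((z j i).toNat, (-z j i).toNat), fun j => ?_, fun j => ?_⟩
    · rw [hP, ← map_nsmul, DiagGroup.smul_single_one, map_zero]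
    · have h1 : v j = ∑ i, z j i • (Pi.single i 1 : DiagGroup d) := by
        rw [← Finset.univ_sum_single (v j)]
        refine Finset.sum_congr rfl fun i _ => ?_
        rw [← Pi.single_smul, ← hz]
        simp
      rw [← hv, h1, map_sum]
      refine Finset.sum_congr rfl fun i _ => ?_
      rw [map_zsmul, hP, Int.toNat_sub_toNat_neg]
  · rintro ⟨P, C, hP, hC⟩
    refine ⟨DiagGroup.lift (fun j => mk R (P j)) hP, surjective_of_forall_var fun j =>
      ⟨∑ i, (((C j i).1 : ℤ) - (C j i).2) • (Pi.single i 1 : DiagGroup d), ?_⟩⟩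
    rw [hC, map_sum]
    refine Finset.sum_congr rfl fun i _ => ?_
    rw [map_zsmul, DiagGroup.lift_single]

/-- A presentation by relations `d j • x_j = 0` and consequences of these. -/
theorem nonempty_equiv_diagGroup {d : Fin n → ℕ}
    (h₁ : ∀ p ∈ R, ∃ j m, d j ∣ m ∧ p = (.nsmul m (.var j), .zero))
    (h₂ : ∀ j, d j ≠ 0 → (.nsmul (d j) (.var j), .zero) ∈ R) :
    Nonempty (PresentedAG R ≃+ DiagGroup d) := by
  let g : PresentedAG R →+ DiagGroup d := lift (fun j => Pi.single j 1) (by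
    intro p hp
    obtain ⟨j, m, ⟨q, rfl⟩, rfl⟩ := h₁ p hp
    simp only [AGTerm.eval_nsmul, AGTerm.eval]
    rw [mul_comm, mul_nsmul', DiagGroup.smul_single_one, smul_zero])
  let f : DiagGroup d →+ PresentedAG R := DiagGroup.lift (fun j => mk R (.var j)) (by
    intro j
    by_cases hj : d j = 0
    -- An infinite factor needs no relation, so the empty presentation is covered with d = 0.
    · rw [hj, zero_nsmul]
    · rw [← mk_nsmul, ← mk_zero, mk_eq_mk]
      exact .of_rel (h₂ j hj))
  have hf : ∀ j, f (Pi.single j 1) = mk R (.var j) := DiagGroup.lift_single _ _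
  have hgf : g.comp f = AddMonoidHom.id _ := DiagGroup.hom_ext fun j => by
    rw [AddMonoidHom.comp_apply, hf]; rfl
  have hbij : Function.Bijective f :=
    ⟨Function.LeftInverse.injective (g := g) fun x => DFunLike.congr_fun hgf x,
      surjective_of_forall_var fun j => ⟨_, hf j⟩⟩
  exact ⟨(AddEquiv.ofBijective f hbij).symm⟩

end PresentedAG

/-! ### Semidecidable predicates -/

/-- `p` is the projection of a computable predicate. -/
def Semidec {α : Type*} [Primcodable α] (p : α → Prop) : Prop :=
  ∃ f : α → ℕ → Bool, Computable₂ f ∧ ∀ a, p a ↔ ∃ k, f a k = true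

namespace Semidec

section Derived

variable {α β : Type*}

/-- The facts obtained by applying a list of rules one after the other, the last one first. -/
def derived [DecidableEq α] (rule : β → List α × α) (l : List β) : List α :=
  l.foldr (fun b acc => if ∀ a ∈ (rule b).1, a ∈ acc then (rule b).2 :: acc else acc) []

theorem derived_cons [DecidableEq α] (rule : β → List α × α) (b : β) (l : List β) :
    derived rule (b :: l) = if ∀ a ∈ (rule b).1, a ∈ derived rule l then
      (rule b).2 :: derived rule l else derived rule l := rfl

theorem derived_subset_append_left [DecidableEq α] (rule : β → List α × α) (l l' : List β) :
    derived rule l ⊆ derived rule (l' ++ l) := by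
  induction l' with
  | nil => simp
  | cons b l' ih =>
    rw [List.cons_append, derived_cons]
    split_ifs
    · exact fun a ha => List.mem_cons_of_mem _ (ih ha)
    · exact ih

/-- Rules applied earlier only supply more premises, so every rule that fired still fires. -/
theorem derived_subset_append_right [DecidableEq α] (rule : β → List α × α) (l l' : List β) :
    derived rule l ⊆ derived rule (l ++ l') := by
  induction l with
  | nil => simp [derived]
  | cons b l ih =>
    rw [List.cons_append, derived_cons, derived_cons]
    by_cases h : ∀ a ∈ (rule b).1, a ∈ derived rule l
    · rw [if_pos h, if_pos fun a ha => ih (h a ha)]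
      exact List.cons_subset_cons _ ih
    · rw [if_neg h]
      split_ifs
      · exact fun a ha => List.mem_cons_of_mem _ (ih ha)
      · exact ih

/-- Derivations of the single facts can be concatenated. -/
theorem exists_derived_of_forall_mem [DecidableEq α] {rule : β → List α × α} {as : List α}
    (h : ∀ a ∈ as, ∃ l, a ∈ derived rule l) : ∃ l, ∀ a ∈ as, a ∈ derived rule l := by
  induction as with
  | nil => exact ⟨[], by simp⟩
  | cons a as ih =>
    obtain ⟨l, hl⟩ := ih fun x hx => h x (List.mem_cons_of_mem _ hx)
    obtain ⟨l', hl'⟩ := h a List.mem_cons_self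
    refine ⟨l' ++ l, List.forall_mem_cons.2 ⟨derived_subset_append_right _ _ _ hl', fun x hx => ?_⟩⟩
    exact derived_subset_append_left _ _ _ (hl x hx)

end Derived

variable {α β : Type*} [Primcodable α] [Primcodable β]

theorem of_iff {p q : α → Prop} (hp : Semidec p) (h : ∀ a, q a ↔ p a) : Semidec q := by
  obtain ⟨f, hf, hpf⟩ := hp
  exact ⟨f, hf, fun a => (h a).trans (hpf a)⟩

theorem comp {p : β → Prop} (hp : Semidec p) {g : α → β} (hg : Computable g) :
    Semidec fun a => p (g a) := by
  obtain ⟨f, hf, hpf⟩ := hp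
  exact ⟨fun a => f (g a), hf.comp (hg.comp Computable.fst) Computable.snd, fun a => hpf _⟩

theorem of_computable {p : α → Prop} {f : α → Bool} (hf : Computable f)
    (h : ∀ a, p a ↔ f a = true) : Semidec p :=
  ⟨fun a _ => f a, hf.comp Computable.fst, fun a => by simp [h]⟩

theorem eq [DecidableEq β] {f g : α → β} (hf : Computable f) (hg : Computable g) :
    Semidec fun a => f a = g a := by
  refine of_computable (f := fun a => decide (f a = g a)) ?_ (by simp)
  exact (Primrec.eq (α := β)).decide.to_comp.comp hf hg

theorem ne [DecidableEq β] {f g : α → β} (hf : Computable f) (hg : Computable g) :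
    Semidec fun a => f a ≠ g a := by
  refine of_computable (f := fun a => !decide (f a = g a)) ?_ (by simp)
  exact Primrec.not.to_comp.comp ((Primrec.eq (α := β)).decide.to_comp.comp hf hg)

theorem and {p q : α → Prop} (hp : Semidec p) (hq : Semidec q) : Semidec fun a => p a ∧ q a := by
  obtain ⟨f, hf, hpf⟩ := hp
  obtain ⟨g, hg, hqg⟩ := hq
  refine ⟨fun a k => f a k.unpair.1 && g a k.unpair.2, ?_, fun a => ?_⟩
  · have h1 := Computable.unpair.comp (Computable.snd (α := α) (β := ℕ))
    exact Primrec.and.to_comp.comp (hf.comp Computable.fst (Computable.fst.comp h1))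
      (hg.comp Computable.fst (Computable.snd.comp h1))
  · refine (and_congr (hpf a) (hqg a)).trans ?_
    constructor
    · rintro ⟨⟨k, hk⟩, l, hl⟩
      exact ⟨Nat.pair k l, by simp [hk, hl]⟩
    · rintro ⟨k, hk⟩
      rw [Bool.and_eq_true] at hk
      exact ⟨⟨_, hk.1⟩, _, hk.2⟩

/-- The search number codes both a candidate witness and a stage of its verification. -/
theorem ex {p : α → β → Prop} (hp : Semidec fun x : α × β => p x.1 x.2) :
    Semidec fun a => ∃ b, p a b := by
  obtain ⟨f, hf, hpf⟩ := hp
  refine ⟨fun a k => (Encodable.decode (α := β) k.unpair.1).elim false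
    fun b => f (a, b) k.unpair.2, ?_, fun a => ?_⟩
  · have h1 := Computable.unpair.comp (Computable.snd (α := α) (β := ℕ))
    refine (Computable.option_casesOn
      (Computable.decode.comp (Computable.fst.comp h1)) (Computable.const false)
      (g := fun (x : α × ℕ) (b : β) => f (x.1, b) x.2.unpair.2) ?_).of_eq ?_
    · exact hf.comp ((Computable.fst.comp Computable.fst).pair Computable.snd)
        (Computable.snd.comp (h1.comp Computable.fst))
    · rintro ⟨a, k⟩
      dsimp only
      cases (Encodable.decode k.unpair.1 : Option β) <;> rfl
  · constructor
    · rintro ⟨b, hb⟩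
      obtain ⟨k, hk⟩ := (hpf (a, b)).1 hb
      exact ⟨Nat.pair (Encodable.encode b) k, by simp [hk]⟩
    · rintro ⟨k, hk⟩
      dsimp only at hk
      cases hb : Encodable.decode (α := β) k.unpair.1 with
      | none => simp [hb] at hk
      | some b =>
        rw [hb] at hk
        exact ⟨b, (hpf (a, b)).2 ⟨_, hk⟩⟩

theorem forall_fin {m : ℕ} {p : Fin m → α → Prop} (hp : ∀ j, Semidec (p j)) :
    Semidec fun a => ∀ j, p j a := by
  induction m with
  | zero => exact of_computable (Computable.const true) fun a => by simp
  | succ m ih =>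
    exact ((hp 0).and (ih fun j => hp j.succ)).of_iff fun a => Fin.forall_fin_succ

/-- Halting is detected by the step-bounded evaluator `evaln`, which is primitive recursive. -/
theorem mem_ceSet : Semidec fun x : ℕ × ℕ => x.2 ∈ ceSet x.1 := by
  refine ⟨fun x k => (Nat.Partrec.Code.evaln k (Denumerable.ofNat _ x.1) x.2).isSome, ?_, ?_⟩
  · refine Primrec.to_comp (Primrec.option_isSome.comp (Nat.Partrec.Code.primrec_evaln.comp
      ((Primrec.snd.pair ?_).pair (Primrec.snd.comp Primrec.fst))))
    exact (Primrec.ofNat Nat.Partrec.Code).comp (Primrec.fst.comp Primrec.fst)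
  · rintro ⟨e, x⟩
    simp only [ceSet, Set.mem_ofPred_eq, Part.dom_iff_mem, Option.isSome_iff_exists,
      Nat.Partrec.Code.evaln_complete, Option.mem_def]
    exact exists_comm

/-- The `s`-`m`-`n` theorem for semidecidable relations. -/
theorem exists_index {p : ℕ → ℕ → Prop} (hp : Semidec fun x : ℕ × ℕ => p x.1 x.2) :
    ∃ g : ℕ → ℕ, Computable g ∧ ∀ e x, x ∈ ceSet (g e) ↔ p e x := by
  obtain ⟨f, hf, hpf⟩ := hp
  have h1 : Partrec fun x : ℕ => Nat.rfind fun k => Part.some (f x.unpair k) :=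
    Partrec.rfind (hf.comp (Computable.unpair.comp Computable.fst) Computable.snd)
  -- A single code searches for a witness for the pair (e, x); currying then fixes e computably.
  obtain ⟨c, hc⟩ := Nat.Partrec.Code.exists_code.1 (Partrec.nat_iff.1 h1)
  refine ⟨fun e => Encodable.encode (c.curry e), ?_, fun e x => ?_⟩
  · exact Computable.encode.comp (Nat.Partrec.Code.primrec₂_curry.to_comp.comp
      (Computable.const c) Computable.id)
  · simp only [ceSet, Set.mem_ofPred_eq, Denumerable.ofNat_encode, Nat.Partrec.Code.eval_curry, hc,
      Nat.unpair_pair, hpf (e, x)]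
    refine (Nat.rfind_dom.trans (exists_congr fun k => ?_))
    exact ⟨fun h => (Part.mem_some_iff.1 h.1).symm,
      fun h => ⟨Part.mem_some_iff.2 h.symm, fun _ => trivial⟩⟩

/-- The fold is a recursion on the position i, whose state is the fold of the first i entries; the
default for a missing entry is never used below the length. -/
theorem computable_list_foldl {σ : Type*} [Primcodable σ] {f : α → List β} {g : α → σ}
    {h : α → σ × β → σ} (hf : Computable f) (hg : Computable g) (hh : Computable₂ h) :
    Computable fun a => (f a).foldl (fun s b => h a (s, b)) (g a) := by
  have h1 : Computable fun a => Nat.rec (motive := fun _ => σ) (g a)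
      (fun i s => ((f a)[i]?).elim s fun b => h a (s, b)) (f a).length := by
    refine Computable.nat_rec (Computable.list_length.comp hf) hg
      (h := fun a (x : ℕ × σ) => ((f a)[x.1]?).elim x.2 fun b => h a (x.2, b)) ?_
    refine (Computable.option_casesOn
      (o := fun x : α × ℕ × σ => (f x.1)[x.2.1]?) (f := fun x => x.2.2)
      (g := fun x b => h x.1 (x.2.2, b)) ?_ (Computable.snd.comp Computable.snd) ?_).of_eq ?_
    · exact Computable.list_getElem?.comp (hf.comp Computable.fst)
        (Computable.fst.comp Computable.snd)
    · exact hh.comp (Computable.fst.comp Computable.fst)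
        ((Computable.snd.comp (Computable.snd.comp Computable.fst)).pair Computable.snd)
    · rintro ⟨a, i, s⟩
      dsimp only
      cases (f a)[i]? <;> rfl
  refine h1.of_eq fun a => ?_
  have h2 : ∀ i ≤ (f a).length, Nat.rec (motive := fun _ => σ) (g a)
      (fun i s => ((f a)[i]?).elim s fun b => h a (s, b)) i =
      ((f a).take i).foldl (fun s b => h a (s, b)) (g a) := by
    intro i hi
    induction i with
    | zero => simp
    | succ i ih =>
      have h3 : (f a)[i]? = some (f a)[i] := List.getElem?_eq_getElem hi
      rw [List.take_add_one, List.foldl_append, ← ih (by omega)]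
      change ((f a)[i]?).elim _ _ = _
      rw [h3]
      rfl
  rw [h2 _ le_rfl, List.take_length]

theorem computable_list_foldr {σ : Type*} [Primcodable σ] {f : α → List β} {g : α → σ}
    {h : α → β × σ → σ} (hf : Computable f) (hg : Computable g) (hh : Computable₂ h) :
    Computable fun a => (f a).foldr (fun b s => h a (b, s)) (g a) := by
  have h1 : Computable₂ fun (a : α) (x : σ × β) => h a (x.2, x.1) :=
    hh.comp Computable.fst ((Computable.snd.comp Computable.snd).pair
      (Computable.fst.comp Computable.snd))
  exact (computable_list_foldl (Computable.list_reverse.comp hf) hg h1).of_eq fun a => by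
    rw [List.foldl_reverse]

theorem computable_derived {γ : Type*} [Primcodable γ] [DecidableEq α]
    {rule : γ → β → List α × α} (hrule : Computable₂ rule) :
    Computable₂ fun c l => derived (rule c) l := by
  refine computable_list_foldr (f := fun x : γ × List β => x.2) (g := fun _ => ([] : List α))
    (h := fun x y => if ∀ a ∈ (rule x.1 y.1).1, a ∈ y.2 then (rule x.1 y.1).2 :: y.2 else y.2)
    Computable.snd (Computable.const _) ?_
  have hr : Computable fun x : (γ × List β) × β × List α => rule x.1.1 x.2.1 :=
    hrule.comp (Computable.fst.comp Computable.fst) (Computable.fst.comp Computable.snd)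
  have hs : Computable fun x : (γ × List β) × β × List α => x.2.2 :=
    Computable.snd.comp Computable.snd
  have hsub : PrimrecRel fun (l l' : List α) => ∀ a ∈ l, a ∈ l' := by
    have h1 : PrimrecRel fun (a : α) (l : List α) => a ∈ l :=
      ((PrimrecRel.exists_mem_list (R := fun a b : α => a = b) Primrec.eq).comp
        Primrec.snd Primrec.fst).of_eq (by simp)
    exact h1.forall_mem_list
  refine (Computable.cond (hsub.decide.to_comp.comp (Computable.fst.comp hr) hs)
    (Computable.list_cons.comp (Computable.snd.comp hr) hs) hs).of_eq fun x => ?_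
  rw [Bool.cond_decide]

/-- A predicate inductively defined by a computable enumeration of rules is semidecidable. -/
theorem of_rules {γ : Type*} [Primcodable γ] [DecidableEq α] {p : γ → α → Prop}
    {rule : γ → β → List α × α} (hrule : Computable₂ rule)
    (hsound : ∀ c b, (∀ a ∈ (rule c b).1, p c a) → p c (rule c b).2)
    (hcomplete : ∀ c (S : Set α), (∀ b, (∀ a ∈ (rule c b).1, a ∈ S) → (rule c b).2 ∈ S) →
      ∀ a, p c a → a ∈ S) :
    Semidec fun x : γ × α => p x.1 x.2 := by
  have h1 : Semidec fun x : γ × α => ∃ l, x.2 ∈ derived (rule x.1) l := by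
    refine ex (of_computable (f := fun x : (γ × α) × List β =>
      decide (∃ b ∈ derived (rule x.1.1) x.2, b = x.1.2)) ?_ (by simp))
    exact (PrimrecRel.exists_mem_list (R := fun a b : α => a = b) Primrec.eq).decide.to_comp.comp
      ((computable_derived hrule).comp (Computable.fst.comp Computable.fst) Computable.snd)
      (Computable.snd.comp Computable.fst)
  refine h1.of_iff ?_
  rintro ⟨c, a⟩
  constructor
  -- The derivable facts are closed under the rules, and `p c` lies in every closed set.
  · refine hcomplete c {a | ∃ l, a ∈ derived (rule c) l} (fun b hb => ?_) a
    obtain ⟨l, hl⟩ := exists_derived_of_forall_mem hb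
    refine ⟨b :: l, ?_⟩
    rw [derived_cons, if_pos hl]
    exact List.mem_cons_self
  · rintro ⟨l, hl⟩
    dsimp only at hl ⊢
    induction l generalizing a with
    | nil => simp [derived] at hl
    | cons b l ih =>
      rw [derived_cons] at hl
      split_ifs at hl with h
      · rcases List.mem_cons.1 hl with rfl | hl
        · exact hsound c b fun a ha => ih a (h a ha)
        · exact ih a hl
      · exact ih a hl

end Semidec

/-! ### Computability of operations on terms -/

namespace AGTerm

variable {n : ℕ}

noncomputable instance : DecidableEq (AGTerm n) := (equivNat n).decidableEq

/-- On Gödel numbers the constructor is an arithmetic function. -/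
theorem primrec_neg : Primrec (neg (n := n)) := by
  refine (Primrec.of_equiv_iff (equivNat n)).1 ?_
  have h1 : Primrec (equivNat n) := Primrec.of_equiv
  exact Primrec.nat_add.comp (Primrec.const (n + 1)) (Primrec.nat_mul.comp (Primrec.const 2) h1)

theorem primrec_add : Primrec₂ (add (n := n)) := by
  refine (Primrec.of_equiv_iff (equivNat n)).1 ?_
  have h1 : Primrec (equivNat n) := Primrec.of_equiv
  exact Primrec.nat_add.comp (Primrec.const (n + 1)) (Primrec.succ.comp
    (Primrec.nat_mul.comp (Primrec.const 2)
      (Primrec₂.natPair.comp (h1.comp Primrec.fst) (h1.comp Primrec.snd))))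

theorem primrec_nsmul : Primrec₂ (nsmul (n := n)) := by
  refine (Primrec.nat_rec' (f := fun x : ℕ × AGTerm n => x.1) (g := fun _ => zero)
    (h := fun x y => add y.2 x.2) Primrec.fst (Primrec.const _) ?_).of_eq ?_
  · exact primrec_add.comp (Primrec.snd.comp Primrec.snd) (Primrec.snd.comp Primrec.fst)
  · rintro ⟨k, t⟩
    dsimp only
    induction k with
    | zero => rfl
    | succ k ih => exact congrArg (add · t) ih

theorem primrec_sum : Primrec (sum (n := n)) :=
  Primrec.list_foldr (h := fun _ (x : AGTerm n × AGTerm n) => add x.1 x.2) Primrec.id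
    (Primrec.const _)
    (primrec_add.comp (Primrec.fst.comp Primrec.snd) (Primrec.snd.comp Primrec.snd))

theorem primrec_comb : Primrec₂ (comb (n := n)) := by
  refine primrec_sum.comp (Primrec.list_ofFn fun i => ?_)
  have hC : Primrec fun x : (Fin n → ℕ × ℕ) × (Fin n → AGTerm n) => x.1 i :=
    Primrec.fin_app.comp Primrec.fst (Primrec.const i)
  have hP : Primrec fun x : (Fin n → ℕ × ℕ) × (Fin n → AGTerm n) => x.2 i :=
    Primrec.fin_app.comp Primrec.snd (Primrec.const i)
  exact primrec_add.comp (primrec_nsmul.comp (Primrec.fst.comp hC) hP)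
    (primrec_neg.comp (primrec_nsmul.comp (Primrec.snd.comp hC) hP))

end AGTerm

/-! ### Derivability from a c.e. set of identities -/

namespace IdentityEncoding

variable {n : ℕ} (c : IdentityEncoding n)

/-- The identities with code in `W_e`. -/
def rels (e : ℕ) : Set (AGTerm n × AGTerm n) := c.decode '' ceSet e

/-- The instances of the rules that generate the congruence `AGCongr (c.rels e)`: for given terms
`s, t, u, v`, and for the code `x` of an identity, if `b` says that `x` has been found in `W_e`. -/
def ruleInstances (s t u v : AGTerm n) (b : Bool) (x : ℕ) :
    List (List (AGTerm n × AGTerm n) × (AGTerm n × AGTerm n)) :=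
  -- As long as x has not been found, the first instance is a harmless trivial identity.
  [([], bif b then c.decode x else (s, s)), ([], (s, s)), ([(s, t)], (t, s)),
    ([(s, t), (t, u)], (s, u)), ([(s, t)], (.neg s, .neg t)),
    ([(s, t), (u, v)], (.add s u, .add t v)),
    ([], (.add (.add s t) u, .add s (.add t u))), ([], (.add s t, .add t s)),
    ([], (.add .zero s, s)), ([], (.add (.neg s) s, .zero))]

theorem computable_ruleInstances {α : Type*} [Primcodable α] {s t u v : α → AGTerm n}
    {b : α → Bool} {x : α → ℕ} (hs : Computable s) (ht : Computable t) (hu : Computable u)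
    (hv : Computable v) (hb : Computable b) (hx : Computable x) :
    Computable fun a => c.ruleInstances (s a) (t a) (u a) (v a) (b a) (x a) := by
  have hadd {f g : α → AGTerm n} (hf : Computable f) (hg : Computable g) :
      Computable fun a => (f a).add (g a) := AGTerm.primrec_add.to_comp.comp hf hg
  have hneg {f : α → AGTerm n} (hf : Computable f) : Computable fun a => (f a).neg :=
    AGTerm.primrec_neg.to_comp.comp hf
  have hcons {β : Type} [Primcodable β] {f : α → β} {l : α → List β} (hf : Computable f)
      (hl : Computable l) : Computable fun a => f a :: l a := Computable.list_cons.comp hf hl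
  have hnil {β : Type} [Primcodable β] : Computable fun _ : α => ([] : List β) :=
    Computable.const _
  have hzero : Computable fun _ : α => (AGTerm.zero : AGTerm n) := Computable.const _
  exact hcons (hnil.pair (Computable.cond hb (c.computable_decode.comp hx) (hs.pair hs))) <|
    hcons (hnil.pair (hs.pair hs)) <|
    hcons ((hcons (hs.pair ht) hnil).pair (ht.pair hs)) <|
    hcons ((hcons (hs.pair ht) (hcons (ht.pair hu) hnil)).pair (hs.pair hu)) <|
    hcons ((hcons (hs.pair ht) hnil).pair ((hneg hs).pair (hneg ht))) <|
    hcons ((hcons (hs.pair ht) (hcons (hu.pair hv) hnil)).pair ((hadd hs hu).pair (hadd ht hv))) <|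
    hcons (hnil.pair ((hadd (hadd hs ht) hu).pair (hadd hs (hadd ht hu)))) <|
    hcons (hnil.pair ((hadd hs ht).pair (hadd ht hs))) <|
    hcons (hnil.pair ((hadd hzero hs).pair hs)) <|
    hcons (hnil.pair ((hadd (hneg hs) hs).pair hzero)) hnil

/-- The congruence is inductively generated, and its rules are computably enumerable once the side
condition x ∈ W_e is replaced by a decidable check at a stage k. -/
theorem semidec_congr :
    Semidec fun x : ℕ × (AGTerm n × AGTerm n) => AGCongr (c.rels x.1) x.2.1 x.2.2 := by
  obtain ⟨f, hf, hW⟩ := Semidec.mem_ceSet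
  -- A rule is given by its position in `ruleInstances`, a pair (x, k), and terms s, t, u, v;
  -- positions past the end yield 0 = 0.
  let rule : ℕ → ℕ × (ℕ × ℕ) × (AGTerm n × AGTerm n) × AGTerm n × AGTerm n →
      List (AGTerm n × AGTerm n) × (AGTerm n × AGTerm n) := fun e y =>
    (c.ruleInstances y.2.2.1.1 y.2.2.1.2 y.2.2.2.1 y.2.2.2.2 (f (e, y.2.1.1) y.2.1.2)
      y.2.1.1).getD y.1 ([], (.zero, .zero))
  refine Semidec.of_rules (p := fun e x => AGCongr (c.rels e) x.1 x.2) (rule := rule) ?_ ?_ ?_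
  · have h1 : Computable fun z : ℕ × ℕ × (ℕ × ℕ) × (AGTerm n × AGTerm n) × AGTerm n × AGTerm n =>
        z.2.2 := Computable.snd.comp Computable.snd
    have h2 := Computable.fst.comp h1
    have h3 := Computable.snd.comp h1
    have h4 := Computable.fst.comp h3
    have h5 := Computable.snd.comp h3
    have h6 := c.computable_ruleInstances (Computable.fst.comp h4) (Computable.snd.comp h4)
      (Computable.fst.comp h5) (Computable.snd.comp h5)
      (hf.comp (Computable.fst.pair (Computable.fst.comp h2)) (Computable.snd.comp h2))
      (Computable.fst.comp h2)
    have h7 : Computable₂ fun (l : List (List (AGTerm n × AGTerm n) × (AGTerm n × AGTerm n)))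
        (i : ℕ) => l.getD i ([], (.zero, .zero)) := (Primrec.list_getD _).to_comp
    exact h7.comp h6 (Computable.fst.comp Computable.snd)
  · rintro e ⟨i, ⟨x, k⟩, ⟨s, t⟩, u, v⟩
    have h1 : ∀ r ∈ c.ruleInstances s t u v (f (e, x) k) x,
        (∀ a ∈ r.1, AGCongr (c.rels e) a.1 a.2) → AGCongr (c.rels e) r.2.1 r.2.2 := by
      simp only [ruleInstances, List.forall_mem_cons, List.not_mem_nil, false_imp_iff,
        implies_true, and_true, forall_const]
      refine ⟨?_, .refl s, .symm, fun h => .trans h.1 h.2, .neg_congr,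
        fun h => .add_congr h.1 h.2, .add_assoc s t u, .add_comm s t, .zero_add s,
        .neg_add_cancel s⟩
      cases hb : f (e, x) k
      · exact .refl s
      · exact .of_rel ⟨x, (hW (e, x)).2 ⟨k, hb⟩, rfl⟩
    simp only [rule, List.getD_eq_getElem?_getD]
    cases hr : (c.ruleInstances s t u v (f (e, x) k) x)[i]? with
    | none => exact fun _ => .refl _
    | some r => exact h1 r (List.mem_of_getElem? hr)
  · rintro e S hS ⟨s, t⟩ h
    dsimp only at h
    induction h with
    | @of_rel s t h =>
      obtain ⟨x, hx, hxd⟩ := h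
      obtain ⟨k, hk⟩ := (hW (e, x)).1 hx
      have := hS (0, (x, k), (s, s), s, s)
      simpa [rule, ruleInstances, hk, hxd] using this
    | refl s => simpa [rule, ruleInstances] using hS (1, (0, 0), (s, s), s, s)
    | @symm s t _ ih => exact hS (2, (0, 0), (s, t), s, s) (by simpa [rule, ruleInstances] using ih)
    | @trans s t u _ _ ih₁ ih₂ =>
      exact hS (3, (0, 0), (s, t), u, s) (by simpa [rule, ruleInstances] using ⟨ih₁, ih₂⟩)
    | @neg_congr s t _ ih =>
      exact hS (4, (0, 0), (s, t), s, s) (by simpa [rule, ruleInstances] using ih)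
    | @add_congr s t u v _ _ ih₁ ih₂ =>
      exact hS (5, (0, 0), (s, t), u, v) (by simpa [rule, ruleInstances] using ⟨ih₁, ih₂⟩)
    | add_assoc s t u =>
      exact hS (6, (0, 0), (s, t), u, s) (by simp [rule, ruleInstances])
    | add_comm s t =>
      exact hS (7, (0, 0), (s, t), s, s) (by simp [rule, ruleInstances])
    | zero_add s =>
      exact hS (8, (0, 0), (s, s), s, s) (by simp [rule, ruleInstances])
    | neg_add_cancel s =>
      exact hS (9, (0, 0), (s, s), s, s) (by simp [rule, ruleInstances])

/-- The group with index `e` is a quotient of `DiagGroup d`. -/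
def IsQuotientOf (e : ℕ) (d : Fin n → ℕ) : Prop :=
  ∃ f : DiagGroup d →+ c.group e, Function.Surjective f

theorem semidec_isQuotientOf :
    Semidec fun x : ℕ × (Fin n → ℕ) => c.IsQuotientOf x.1 x.2 := by
  refine Semidec.of_iff (p := fun x : ℕ × (Fin n → ℕ) =>
      ∃ (P : Fin n → AGTerm n) (C : Fin n → Fin n → ℕ × ℕ),
        (∀ j, AGCongr (c.rels x.1) (.nsmul (x.2 j) (P j)) .zero) ∧
          ∀ j, AGCongr (c.rels x.1) (.var j) (.comb (C j) P)) ?_ fun x =>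
    PresentedAG.exists_surjective_diagGroup_iff
  have h1 : Computable fun x : ((ℕ × (Fin n → ℕ)) × (Fin n → AGTerm n)) ×
      (Fin n → Fin n → ℕ × ℕ) => x.1.1.1 :=
    Computable.fst.comp (Computable.fst.comp Computable.fst)
  have h2 : Computable fun x : ((ℕ × (Fin n → ℕ)) × (Fin n → AGTerm n)) ×
      (Fin n → Fin n → ℕ × ℕ) => x.1.2 := Computable.snd.comp Computable.fst
  refine Semidec.ex (Semidec.ex (Semidec.and (Semidec.forall_fin fun j => ?_)
    (Semidec.forall_fin fun j => ?_)))
  · refine c.semidec_congr.comp (h1.pair (Computable.pair (AGTerm.primrec_nsmul.to_comp.comp ?_ ?_)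
      (Computable.const .zero)))
    · exact Computable.fin_app.comp (Computable.snd.comp (Computable.fst.comp Computable.fst))
        (Computable.const j)
    · exact Computable.fin_app.comp h2 (Computable.const j)
  · exact c.semidec_congr.comp (h1.pair ((Computable.const (.var j)).pair
      (AGTerm.primrec_comb.to_comp.comp
        (Computable.fin_app.comp Computable.snd (Computable.const j)) h2)))

end IdentityEncoding

/-! ### The order on the codes of ordinals below `ω * n` -/

theorem omega0_mul_add_le_iff {i k i' k' : ℕ} :
    ω * (i : Ordinal.{0}) + k ≤ ω * i' + k' ↔ i < i' ∨ i = i' ∧ k ≤ k' := by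
  rcases lt_trichotomy i i' with h | rfl | h
  · have h1 : ω * (i : Ordinal.{0}) + k ≤ ω * i' + k' :=
      (omega0_mul_add_lt h).le.trans le_self_add
    simp [h, h1]
  · simp
  · have h1 : ω * (i' : Ordinal.{0}) + k' < ω * i + k :=
      (omega0_mul_add_lt h).trans_le le_self_add
    simp [h.not_gt, h.ne', h1]

namespace OrdinalEncoding

theorem exists_isLeastWrt {α : Ordinal.{0}} (h : OrdinalEncoding α) {S : Set ℕ} (hS : S.Nonempty) :
    ∃ m, IsLeastWrt h.le S m := by
  obtain ⟨m, hm, hmin⟩ := (InvImage.wf (fun x => cnfValue (h.decode x)) lt_wf).has_min S hS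
  exact ⟨m, hm, fun x hx => not_lt.1 (hmin x hx)⟩

variable {n : ℕ} (h : OrdinalEncoding (ω * (n : Ordinal.{0})))

theorem le_iff {x y i k i' k' : ℕ} (hx : h.decode x = cnfPair i k) (hy : h.decode y = cnfPair i' k') :
    h.le x y ↔ i < i' ∨ i = i' ∧ k ≤ k' := by
  rw [OrdinalEncoding.le, hx, hy, cnfValue_cnfPair, cnfValue_cnfPair, omega0_mul_add_le_iff]

theorem exists_decode_eq_cnfPair {i : ℕ} (hi : i < n) (k : ℕ) :
    ∃ x, h.decode x = cnfPair i k := by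
  obtain ⟨x, -, hx⟩ := h.bijOn_decode.surjOn
    (show cnfPair i k ∈ _ from ⟨isCNF_cnfPair i k, by
      rw [cnfValue_cnfPair]; exact omega0_mul_add_lt hi⟩)
  exact ⟨x, hx⟩

theorem exists_cnfPair_eq_decode (x : ℕ) : ∃ i < n, ∃ k, h.decode x = cnfPair i k :=
  eq_cnfPair (h.bijOn_decode.mapsTo (Set.mem_univ x)).1 (h.bijOn_decode.mapsTo (Set.mem_univ x)).2

theorem decode_injective : Function.Injective h.decode :=
  Set.injOn_univ.1 h.bijOn_decode.injOn

end OrdinalEncoding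

theorem primrec_cnfPair : Primrec₂ cnfPair := by
  refine Primrec.list_append.comp (Primrec.ite ?_ (Primrec.const _) ?_)
    (Primrec.ite ?_ (Primrec.const _) ?_)
  · exact Primrec.eq.comp Primrec.fst (Primrec.const 0)
  · exact Primrec.list_cons.comp ((Primrec.const 1).pair Primrec.fst) (Primrec.const [])
  · exact Primrec.eq.comp Primrec.snd (Primrec.const 0)
  · exact Primrec.list_cons.comp ((Primrec.const 0).pair Primrec.snd) (Primrec.const [])

theorem primrec_nat_pow : Primrec₂ fun b k : ℕ => b ^ k := by
  refine (Primrec.nat_rec (f := fun _ : ℕ => 1) (g := fun b x => x.2 * b) (Primrec.const 1)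
    (Primrec.nat_mul.comp (Primrec.snd.comp Primrec.snd) Primrec.fst)).of_eq fun b k => ?_
  induction k with
  | zero => rfl
  | succ k ih => rw [pow_succ, ← ih]

/-! ### Numbering products of cyclic groups -/

namespace DiagGroup

variable {n : ℕ}

/-- An injective numbering of the tuples `d` that is increasing in the order of the torsion
subgroup of `DiagGroup d`. -/
def index (d : Fin n → ℕ) : ℕ :=
  torsionCard d * (torsionCard d + 1) ^ n + Nat.ofDigits (torsionCard d + 1) (List.ofFn d)

theorem le_torsionCard (d : Fin n → ℕ) (j : Fin n) : d j ≤ torsionCard d := by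
  by_cases hj : d j = 0
  · omega
  · refine Nat.le_of_dvd (torsionCard_pos d) ?_
    have := Finset.dvd_prod_of_mem (fun j => if d j = 0 then 1 else d j) (Finset.mem_univ j)
    rw [if_neg hj] at this
    exact this

theorem forall_mem_ofFn_lt (d : Fin n → ℕ) : ∀ x ∈ List.ofFn d, x < torsionCard d + 1 := by
  intro x hx
  obtain ⟨j, rfl⟩ := (List.mem_ofFn' d x).1 hx
  exact Nat.lt_succ_of_le (le_torsionCard d j)

theorem one_lt_torsionCard_add_one (d : Fin n → ℕ) : 1 < torsionCard d + 1 :=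
  Nat.succ_lt_succ (torsionCard_pos d)

/-- With t the torsion order of d, the entries of d are n digits in base t + 1, so their part stays
below (t + 1)^n and the index below (t + 1) · (t + 1)^n. -/
theorem index_lt_index {d d' : Fin n → ℕ} (h : torsionCard d < torsionCard d') :
    index d < index d' := by
  have h1 := Nat.ofDigits_lt_base_pow_length (one_lt_torsionCard_add_one d) (forall_mem_ofFn_lt d)
  rw [List.length_ofFn] at h1
  calc index d < torsionCard d * (torsionCard d + 1) ^ n + (torsionCard d + 1) ^ n :=
        Nat.add_lt_add_left h1 _
    _ = (torsionCard d + 1) * (torsionCard d + 1) ^ n := by ring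
    _ ≤ torsionCard d' * (torsionCard d' + 1) ^ n := by gcongr; omega
    _ ≤ index d' := Nat.le_add_right _ _

/-- Equal indices force equal torsion orders, hence a common base, in which the digits are
determined. -/
theorem index_injective : Function.Injective (index (n := n)) := by
  intro d d' h
  have ht : torsionCard d = torsionCard d' := by
    rcases lt_trichotomy (torsionCard d) (torsionCard d') with h1 | h1 | h1
    · exact absurd h (index_lt_index h1).ne
    · exact h1
    · exact absurd h (index_lt_index h1).ne'
  have hd' := forall_mem_ofFn_lt d'
  rw [index, index, ← ht] at h
  rw [← ht] at hd'
  exact List.ofFn_injective (Nat.ofDigits_inj_of_len_eq (one_lt_torsionCard_add_one d) (by simp)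
    (forall_mem_ofFn_lt d) hd' (Nat.add_left_cancel h))

theorem primrec_apply (j : Fin n) : Primrec fun d : Fin n → ℕ => d j :=
  Primrec.fin_app.comp Primrec.id (Primrec.const j)

theorem primrec_rank : Primrec (rank (n := n)) := by
  refine (Primrec.list_foldr (f := fun d : Fin n → ℕ => List.ofFn fun j => if d j = 0 then 1 else 0)
    (g := fun _ => 0) (h := fun _ (x : ℕ × ℕ) => x.1 + x.2)
    (Primrec.list_ofFn fun j => Primrec.ite (Primrec.eq.comp (primrec_apply j) (Primrec.const 0))
      (Primrec.const 1) (Primrec.const 0)) (Primrec.const 0)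
    (Primrec.nat_add.comp (Primrec.fst.comp Primrec.snd) (Primrec.snd.comp Primrec.snd))).of_eq
    fun d => ?_
  rw [rank, ← List.sum_ofFn, List.sum]

theorem primrec_torsionCard : Primrec (torsionCard (n := n)) := by
  refine (Primrec.list_foldr
    (f := fun d : Fin n → ℕ => List.ofFn fun j => if d j = 0 then 1 else d j)
    (g := fun _ => 1) (h := fun _ (x : ℕ × ℕ) => x.1 * x.2)
    (Primrec.list_ofFn fun j => Primrec.ite (Primrec.eq.comp (primrec_apply j) (Primrec.const 0))
      (Primrec.const 1) (primrec_apply j)) (Primrec.const 1)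
    (Primrec.nat_mul.comp (Primrec.fst.comp Primrec.snd) (Primrec.snd.comp Primrec.snd))).of_eq
    fun d => ?_
  rw [torsionCard, ← List.prod_ofFn, List.prod]

theorem primrec_index : Primrec (index (n := n)) := by
  have hb : Primrec fun d : Fin n → ℕ => torsionCard d + 1 := Primrec.succ.comp primrec_torsionCard
  refine Primrec.nat_add.comp (Primrec.nat_mul.comp primrec_torsionCard
    (primrec_nat_pow.comp hb (Primrec.const n))) ?_
  refine (Primrec.list_foldr (f := fun d : Fin n → ℕ => List.ofFn d)
    (g := fun _ => 0) (h := fun d (x : ℕ × ℕ) => x.1 + (torsionCard d + 1) * x.2)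
    (Primrec.list_ofFn primrec_apply) (Primrec.const 0)
    (Primrec.nat_add.comp (Primrec.fst.comp Primrec.snd)
      (Primrec.nat_mul.comp (hb.comp Primrec.fst) (Primrec.snd.comp Primrec.snd)))).of_eq fun d => ?_
  rw [Nat.ofDigits_eq_foldr]
  rfl

end DiagGroup

/-! ### Isomorphism of presented groups reduces to `E_min` -/

section IsoToEMin

variable {n : ℕ} (c : IdentityEncoding n) (h : OrdinalEncoding (ω * (n : Ordinal.{0})))

theorem IdentityEncoding.exists_group_equiv (e : ℕ) :
    ∃ d : Fin n → ℕ, Nonempty (c.group e ≃+ DiagGroup d) :=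
  PresentedAG.exists_equiv_diagGroup (c.rels e)

theorem IdentityEncoding.IsQuotientOf.of_equiv {e i : ℕ} {d : Fin n → ℕ}
    (hd : c.IsQuotientOf e d) (g : c.group e ≃+ c.group i) : c.IsQuotientOf i d := by
  obtain ⟨f, hf⟩ := hd
  exact ⟨g.toAddMonoidHom.comp f, g.surjective.comp hf⟩

/-- `x` codes the rank and the number of a product of cyclic groups, not all of them infinite, of
which the group with index `e` is a quotient. -/
def CodesCover (e x : ℕ) : Prop :=
  -- The tuple d = 0 has rank n, and ω · n + k has no code.
  ∃ d : Fin n → ℕ, d ≠ 0 ∧ h.decode x = cnfPair (DiagGroup.rank d) (DiagGroup.index d) ∧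
    c.IsQuotientOf e d

theorem semidec_codesCover : Semidec fun x : ℕ × ℕ => CodesCover c h x.1 x.2 := by
  refine Semidec.ex ((Semidec.ne Computable.snd (Computable.const 0)).and (Semidec.and
    (Semidec.eq ?_ ?_) ?_))
  · exact h.computable_decode.comp (Computable.snd.comp Computable.fst)
  · exact primrec_cnfPair.to_comp.comp (DiagGroup.primrec_rank.to_comp.comp Computable.snd)
      (DiagGroup.primrec_index.to_comp.comp Computable.snd)
  · exact c.semidec_isQuotientOf.comp
      ((Computable.fst.comp Computable.fst).pair Computable.snd)

variable {c h}

theorem CodesCover.exists_of_equiv {e : ℕ} {d : Fin n → ℕ} (hd : d ≠ 0)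
    (g : c.group e ≃+ DiagGroup d) :
    ∃ x, h.decode x = cnfPair (DiagGroup.rank d) (DiagGroup.index d) ∧ CodesCover c h e x := by
  obtain ⟨x, hx⟩ := h.exists_decode_eq_cnfPair (DiagGroup.rank_lt hd) (DiagGroup.index d)
  exact ⟨x, hx, d, hd, hx, g.symm.toAddMonoidHom, g.symm.surjective⟩

theorem DiagGroup.rank_le_of_surjective {d d' : Fin n → ℕ} {f : DiagGroup d →+ DiagGroup d'}
    (hf : Function.Surjective f) : rank d' ≤ rank d := by
  simpa only [DiagGroup.finrank_eq] using finrank_int_le_of_surjective hf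

/-- The least code of a cover is the code of the group itself. -/
theorem equiv_of_isLeastWrt {e m : ℕ} (hm : IsLeastWrt h.le {x | CodesCover c h e x} m)
    {d : Fin n → ℕ} (hdm : h.decode m = cnfPair (DiagGroup.rank d) (DiagGroup.index d)) :
    Nonempty (c.group e ≃+ DiagGroup d) := by
  obtain ⟨d₁, hd, hd₁, f, hf⟩ := hm.1
  obtain rfl : d = d₁ := DiagGroup.index_injective (cnfPair_injective (hdm.symm.trans hd₁)).2
  obtain ⟨d', ⟨g⟩⟩ := c.exists_group_equiv e
  let f' : DiagGroup d →+ DiagGroup d' := g.toAddMonoidHom.comp f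
  have hf' : Function.Surjective f' := g.surjective.comp hf
  have hr := DiagGroup.rank_le_of_surjective hf'
  have hd' : d' ≠ 0 := by
    rintro rfl
    rw [DiagGroup.rank_zero] at hr
    exact absurd (DiagGroup.rank_lt hd) hr.not_gt
  obtain ⟨x, hx, hxc⟩ := CodesCover.exists_of_equiv (h := h) hd' g
  -- The group itself is among the covers, so minimality bounds (rank d, index d) by (rank d', index
  -- d'). As rank d' ≤ rank d, the ranks agree.
  have hle := (h.le_iff hdm hx).1 (hm.2 x hxc)
  have hr' : DiagGroup.rank d' = DiagGroup.rank d := by omega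
  have hidx : DiagGroup.index d ≤ DiagGroup.index d' := by omega
  have hrank : Module.finrank ℤ (DiagGroup d') = Module.finrank ℤ (DiagGroup d) := by
    rw [DiagGroup.finrank_eq, DiagGroup.finrank_eq, hr']
  have ht := card_torsion_le_of_surjective hf' hrank
  have ht' : Nat.card (Submodule.torsion ℤ (DiagGroup d')) =
      Nat.card (Submodule.torsion ℤ (DiagGroup d)) := by
    rw [DiagGroup.card_torsion, DiagGroup.card_torsion] at ht ⊢
    -- A smaller torsion order for d' would give it a smaller index, against minimality.
    refine ht.antisymm (not_lt.1 fun hlt => ?_)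
    exact absurd (DiagGroup.index_lt_index hlt) hidx.not_gt
  exact ⟨g.trans (AddEquiv.ofBijective f'
    ⟨injective_of_surjective_of_card_torsion_eq hf' hrank ht', hf'⟩).symm⟩

/-- A group isomorphic to `DiagGroup d` with d ≠ 0 would contribute its own code. -/
theorem equiv_zero_of_not_codesCover {e : ℕ} (he : ∀ x, ¬CodesCover c h e x) :
    Nonempty (c.group e ≃+ DiagGroup (0 : Fin n → ℕ)) := by
  obtain ⟨d, ⟨g⟩⟩ := c.exists_group_equiv e
  by_cases hd : d = 0
  · exact hd ▸ ⟨g⟩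
  · obtain ⟨x, -, hx⟩ := CodesCover.exists_of_equiv (h := h) hd g
    exact absurd hx (he x)

theorem codesCover_congr {e i : ℕ} (g : c.group e ≃+ c.group i) (x : ℕ) :
    CodesCover c h e x ↔ CodesCover c h i x :=
  ⟨fun ⟨d, hd, hx, hq⟩ => ⟨d, hd, hx, hq.of_equiv c g⟩,
    fun ⟨d, hd, hx, hq⟩ => ⟨d, hd, hx, hq.of_equiv c g.symm⟩⟩

variable (c h)

theorem compReducible_iso_eMin : CompReducible c.iso h.eMin := by
  obtain ⟨g, hg, hW⟩ := (semidec_codesCover c h).exists_index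
  have hW' (e : ℕ) : ceSet (g e) = {x | CodesCover c h e x} := Set.ext fun x => hW e x
  refine ⟨g, hg, fun e i => ?_⟩
  simp only [OrdinalEncoding.eMin, EMin, hW']
  constructor
  · rintro ⟨k⟩
    have hS : {x | CodesCover c h e x} = {x | CodesCover c h i x} :=
      Set.ext fun x => codesCover_congr k x
    rw [hS, and_self]
    rcases Set.eq_empty_or_nonempty {x | CodesCover c h i x} with h0 | h0
    · exact .inr h0
    · obtain ⟨m, hm⟩ := h.exists_isLeastWrt h0
      exact .inl ⟨m, hm, hm⟩
  · rintro (⟨m, hme, hmi⟩ | ⟨he, hi⟩)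
    · obtain ⟨d, -, hd, -⟩ := hme.1
      obtain ⟨k⟩ := equiv_of_isLeastWrt hme hd
      obtain ⟨l⟩ := equiv_of_isLeastWrt hmi hd
      exact ⟨k.trans l.symm⟩
    · obtain ⟨k⟩ := equiv_zero_of_not_codesCover (Set.eq_empty_iff_forall_notMem.1 he)
      obtain ⟨l⟩ := equiv_zero_of_not_codesCover (Set.eq_empty_iff_forall_notMem.1 hi)
      exact ⟨k.trans l.symm⟩

end IsoToEMin

/-! ### `E_min` reduces to isomorphism of presented groups -/

namespace DiagGroup

variable {n : ℕ}

/-- The tuple `(0, …, 0, 2 ^ k, 1, …, 1)` with `i` zeros. -/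
def chain (n i k : ℕ) (j : Fin n) : ℕ := if (j : ℕ) < i then 0 else if (j : ℕ) = i then 2 ^ k else 1

theorem rank_chain {i : ℕ} (hi : i < n) (k : ℕ) : rank (chain n i k) = i := by
  have h1 (j : Fin n) : chain n i k j = 0 ↔ (j : ℕ) < i := by
    unfold chain; split_ifs <;> simp_all
  simp only [rank, h1]
  rw [Finset.sum_boole, Fin.card_filter_val_lt]
  simp [hi.le]

theorem torsionCard_chain {i : ℕ} (hi : i < n) (k : ℕ) : torsionCard (chain n i k) = 2 ^ k := by
  rw [torsionCard, Finset.prod_eq_single ⟨i, hi⟩]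
  · simp [chain]
  · intro j _ hj
    have : (j : ℕ) ≠ i := fun h => hj (Fin.ext h)
    simp [chain, this]
  · simp

/-- In the divisibility order 1 is least and 0 greatest. Raising the ordinal turns entries into
multiples, so the relations d_j x_j = 0 become weaker. -/
theorem chain_dvd_chain {i k i' k' : ℕ} (h : i < i' ∨ i = i' ∧ k ≤ k') (j : Fin n) :
    chain n i k j ∣ chain n i' k' j := by
  by_cases h1 : (j : ℕ) < i'
  · rw [chain, chain, if_pos h1]; exact dvd_zero _
  · rcases h with h | ⟨rfl, h⟩
    · rw [chain, if_neg (by omega), if_neg (by omega)]; exact one_dvd _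
    · rw [chain, chain, if_neg h1, if_neg h1]
      split_ifs
      · exact pow_dvd_pow 2 h
      · exact one_dvd _

/-- The rank recovers i and the torsion order 2^k recovers k. -/
theorem chain_equiv_iff {i k i' k' : ℕ} (hi : i < n) (hi' : i' < n) :
    Nonempty (DiagGroup (chain n i k) ≃+ DiagGroup (chain n i' k')) ↔ i = i' ∧ k = k' := by
  constructor
  · rintro ⟨g⟩
    have h1 := finrank_int_eq_of_equiv g
    have h2 := card_torsion_eq_of_equiv g
    rw [finrank_eq, finrank_eq, rank_chain hi, rank_chain hi'] at h1
    rw [card_torsion, card_torsion, torsionCard_chain hi, torsionCard_chain hi'] at h2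
    exact ⟨h1, Nat.pow_right_injective le_rfl h2⟩
  · rintro ⟨rfl, rfl⟩
    exact ⟨AddEquiv.refl _⟩

theorem isEmpty_zero_equiv_chain {i : ℕ} (hi : i < n) (k : ℕ) :
    IsEmpty (DiagGroup (0 : Fin n → ℕ) ≃+ DiagGroup (chain n i k)) := by
  refine ⟨fun g => ?_⟩
  have h1 := finrank_int_eq_of_equiv g
  rw [finrank_eq, finrank_eq, rank_chain hi, rank_zero] at h1
  exact hi.ne' h1

theorem primrec_chain : Primrec fun x : ℕ × ℕ × Fin n => chain n x.1 x.2.1 x.2.2 := by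
  have hj : Primrec fun x : ℕ × ℕ × Fin n => (x.2.2 : ℕ) :=
    Primrec.fin_val.comp (Primrec.snd.comp Primrec.snd)
  exact Primrec.ite (Primrec.nat_lt.comp hj Primrec.fst) (Primrec.const 0)
    (Primrec.ite (Primrec.eq.comp hj Primrec.fst)
      (primrec_nat_pow.comp (Primrec.const 2) (Primrec.fst.comp Primrec.snd)) (Primrec.const 1))

end DiagGroup

section EMinToIso

variable {n : ℕ} (c : IdentityEncoding n) (h : OrdinalEncoding (ω * (n : Ordinal.{0})))

/-- `y` codes a defining relation of the group that belongs to one of the ordinals in `W_e`. -/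
def CodesRelation (e y : ℕ) : Prop :=
  ∃ (x : ℕ) (z : ℕ × ℕ × Fin n), x ∈ ceSet e ∧ h.decode x = cnfPair z.1 z.2.1 ∧
    c.decode y = (.nsmul (DiagGroup.chain n z.1 z.2.1 z.2.2) (.var z.2.2), .zero)

theorem semidec_codesRelation : Semidec fun x : ℕ × ℕ => CodesRelation c h x.1 x.2 := by
  have hx : Computable fun w : ((ℕ × ℕ) × ℕ) × ℕ × ℕ × Fin n => w.1.2 :=
    Computable.snd.comp Computable.fst
  have hz : Computable fun w : ((ℕ × ℕ) × ℕ) × ℕ × ℕ × Fin n => w.2 := Computable.snd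
  have hey : Computable fun w : ((ℕ × ℕ) × ℕ) × ℕ × ℕ × Fin n => w.1.1 :=
    Computable.fst.comp Computable.fst
  refine Semidec.ex (Semidec.ex (Semidec.and ?_ (Semidec.and (Semidec.eq ?_ ?_)
    (Semidec.eq ?_ (Computable.pair (AGTerm.primrec_nsmul.to_comp.comp ?_ ?_)
      (Computable.const _))))))
  · exact Semidec.mem_ceSet.comp ((Computable.fst.comp hey).pair hx)
  · exact h.computable_decode.comp hx
  · exact primrec_cnfPair.to_comp.comp (Computable.fst.comp hz)
      (Computable.fst.comp (Computable.snd.comp hz))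
  · exact c.computable_decode.comp (Computable.snd.comp hey)
  · exact DiagGroup.primrec_chain.to_comp.comp hz
  · exact (Primrec.dom_finite AGTerm.var).to_comp.comp (Computable.snd.comp (Computable.snd.comp hz))

variable {c h}

/-- The least ordinal imposes the strongest relations; all others are consequences. -/
theorem group_equiv_chain {e i m j k : ℕ} (he : ∀ y, y ∈ ceSet i ↔ CodesRelation c h e y)
    (hm : IsLeastWrt h.le (ceSet e) m) (hmk : h.decode m = cnfPair j k) :
    Nonempty (c.group i ≃+ DiagGroup (DiagGroup.chain n j k)) := by
  refine PresentedAG.nonempty_equiv_diagGroup (R := c.decode '' ceSet i) ?_ ?_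
  · rintro _ ⟨y, hy, rfl⟩
    obtain ⟨x, ⟨j', k', l⟩, hx, hxd, hyd⟩ := (he y).1 hy
    exact ⟨l, _, DiagGroup.chain_dvd_chain ((h.le_iff hmk hxd).1 (hm.2 x hx)) l, hyd⟩
  · intro l _
    obtain ⟨y, hy⟩ := c.bijective_decode.2 (.nsmul (DiagGroup.chain n j k l) (.var l), .zero)
    exact ⟨y, (he y).2 ⟨m, (j, k, l), hm.1, hmk, hy⟩, hy⟩

theorem group_equiv_zero {e i : ℕ} (hi : ∀ y, y ∈ ceSet i ↔ CodesRelation c h e y)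
    (he : ceSet e = ∅) : Nonempty (c.group i ≃+ DiagGroup (0 : Fin n → ℕ)) := by
  refine PresentedAG.nonempty_equiv_diagGroup (R := c.decode '' ceSet i) ?_ ?_
  · rintro _ ⟨y, hy, rfl⟩
    obtain ⟨x, _, hx, -⟩ := (hi y).1 hy
    exact absurd hx (he ▸ Set.notMem_empty x)
  · exact fun j hj => absurd rfl hj

variable (c h)

theorem compReducible_eMin_iso : CompReducible h.eMin c.iso := by
  obtain ⟨g, hg, hW⟩ := (semidec_codesRelation c h).exists_index
  -- Each constructed group has one of the normal forms, which are pairwise non-isomorphic; hence an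
  -- isomorphism forces equal least elements or two empty sets.
  have hcases (e : ℕ) : (ceSet e = ∅ ∧ Nonempty (c.group (g e) ≃+ DiagGroup (0 : Fin n → ℕ))) ∨
      ∃ m j k, j < n ∧ IsLeastWrt h.le (ceSet e) m ∧ h.decode m = cnfPair j k ∧
        Nonempty (c.group (g e) ≃+ DiagGroup (DiagGroup.chain n j k)) := by
    rcases Set.eq_empty_or_nonempty (ceSet e) with h0 | h0
    · exact .inl ⟨h0, group_equiv_zero (hW e) h0⟩
    · obtain ⟨m, hm⟩ := h.exists_isLeastWrt h0
      obtain ⟨j, hj, k, hmk⟩ := h.exists_cnfPair_eq_decode m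
      exact .inr ⟨m, j, k, hj, hm, hmk, group_equiv_chain (hW e) hm hmk⟩
  refine ⟨g, hg, fun e i => ?_⟩
  constructor
  · rintro (⟨m, hme, hmi⟩ | ⟨he, hi⟩)
    · obtain ⟨j, -, k, hmk⟩ := h.exists_cnfPair_eq_decode m
      obtain ⟨p⟩ := group_equiv_chain (hW e) hme hmk
      obtain ⟨q⟩ := group_equiv_chain (hW i) hmi hmk
      exact ⟨p.trans q.symm⟩
    · obtain ⟨p⟩ := group_equiv_zero (hW e) he
      obtain ⟨q⟩ := group_equiv_zero (hW i) hi
      exact ⟨p.trans q.symm⟩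
  · rintro ⟨r⟩
    rcases hcases e with ⟨he, ⟨p⟩⟩ | ⟨m, j, k, hj, hm, hmk, ⟨p⟩⟩ <;>
      rcases hcases i with ⟨hi, ⟨q⟩⟩ | ⟨m', j', k', hj', hm', hmk', ⟨q⟩⟩
    · exact .inr ⟨he, hi⟩
    · exact (DiagGroup.isEmpty_zero_equiv_chain hj' k').elim (p.symm.trans (r.trans q))
    · exact (DiagGroup.isEmpty_zero_equiv_chain hj k).elim (q.symm.trans (r.symm.trans p))
    · obtain ⟨rfl, rfl⟩ := (DiagGroup.chain_equiv_iff hj hj').1 ⟨p.symm.trans (r.trans q)⟩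
      obtain rfl := h.decode_injective (hmk.trans hmk'.symm)
      exact .inl ⟨m, hm, hm'⟩

end EMinToIso

/-- For every `n ≥ 1`, isomorphism of `n`-generated c.e. abelian groups is computably bi-reducible
with `E_min(ω · n)`, whatever the computable bijective encodings of identities and of ordinals. -/
theorem mainTheorem4 (n : ℕ) (hn : 1 ≤ n) (c : IdentityEncoding n)
    (h : OrdinalEncoding (Ordinal.omega0 * (n : Ordinal.{0}))) :
    CompBireducible c.iso h.eMin :=
  ⟨compReducible_iso_eMin c h, compReducible_eMin_iso c h⟩
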